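/- Let $K$ be a field of characteristic zero, $R=K[x_1,\dots,x_n]$ and $\tilde R=R[z]$ with the standard gradings. Let $p_i=x_1^i+\cdots+x_n^i$ and $\tilde p_i=p_i+z^i$ be the power sums, and let $e_i\in R$ be the elementary symmetric polynomial of degree $i$ with sign, so that $\prod_{i=1}^n(z-x_i)=\sum_{i=0}^n e_i z^{n-i}$. Let $a\ge 1$ be an integer, $I=(\tilde p_a,\tilde p_{a+1},\dots,\tilde p_{a+n})\subset\tilde R$, $A=\tilde R/I$, and let $\bar z$ be the image of $z$ in $A$. For a commutative ring $B$ and a nilpotent $y\in B$, let $p$ be the least exponent with $y^p=0$. The central simple modules $U_1,U_2,\dots,U_s$ of $(B,y)$ are the non-zero modules among $$\frac{(0:y^{p-i})+(y)}{(0:y^{p-i-1})+(y)},\qquad i=0,1,\dots,p-1,$$ listed in the order of increasing $i$. Then $A$ is an Artinian complete intersection, that is, $A$ is Artinian and $\tilde p_a,\dots,\tilde p_{a+n}$ is a regular sequence in $\tilde R$. Moreover: (1) If $a=1$, then $(A,\bar z)$ has exactly one central simple module $U_1$, and $U_1\cong R/(e_1,e_2,\dots,e_n)$. (2) If $a\ge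 2$, then $(A,\bar z)$ has exactly $n+1$ central simple modules, and $$U_j\cong \frac{R}{(p_{a-1},p_a,\dots,p_{a+j-3},\,e_j,e_{j+1},\dots,e_n)}\qquad (j=1,2,\dots,n+1),$$ with $j-1$ power sums and $n-j+1$ elementary symmetric polynomials among the generators. Here $\cong$ denotes an isomorphism of graded $\tilde R$-modules up to a shift of degrees, where $\tilde R$ acts on a quotient of $R$ through $x_i\mapsto x_i$, $z\mapsto 0$. -/

import Mathlib

open MvPolynomial

noncomputable section

namespace PowerSumCI

/-! ### Central simple modules of a pair `(A, y)` -/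

section CentralSimple

variable {A : Type*} [CommRing A]

/-- The ideal `(0 : y ^ i) + (y)` of `A`. -/
def chainIdeal (y : A) (i : ℕ) : Ideal A :=
  (⊥ : Ideal A).colon {y ^ i} ⊔ Ideal.span {y}

/-- The successive quotient `((0 : y ^ (p - i)) + (y)) / ((0 : y ^ (p - i - 1)) + (y))`, an
`A`-module, where `p = nilpotencyClass y` is the least exponent with `y ^ p = 0`. -/
abbrev SuccQuot (y : A) (i : ℕ) : Type _ :=
  ↥(chainIdeal y (nilpotencyClass y - i)) ⧸
    Submodule.submoduleOf (chainIdeal y (nilpotencyClass y - i - 1))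
      (chainIdeal y (nilpotencyClass y - i))

open Classical in
/-- The indices `i = 0, …, p - 1` whose successive quotient is non-zero. -/
def csmIndices (y : A) : Finset ℕ :=
  (Finset.range (nilpotencyClass y)).filter fun i => Nontrivial (SuccQuot y i)

/-- The number `s` of central simple modules of `(A, y)`. -/
def numCSM (y : A) : ℕ := (csmIndices y).card

/-- The index `i` of the successive quotient that is renamed `U_{j+1}`: the indices of the non-zero
quotients, listed in increasing order. -/
def csmIndex (y : A) (j : Fin (numCSM y)) : ℕ :=
  (csmIndices y).orderEmbOfFin rfl j

/-- The central simple modules of `(A, y)`. They are counted from `0` here: `CSM y j` is the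
`(j + 1)`-st central simple module `U_{j+1}`. -/
abbrev CSM (y : A) (j : Fin (numCSM y)) : Type _ := SuccQuot y (csmIndex y j)

/-- For `A` graded by `𝒜`, the component of degree `d` of a central simple module: the classes of
the elements of degree `d` of the ideal in the numerator. -/
def csmComponent {K : Type*} [Field K] [Algebra K A] (𝒜 : ℕ → Submodule K A) (y : A)
    (j : Fin (numCSM y)) (d : ℕ) : Submodule K (CSM y j) :=
  ((𝒜 d).comap
    ((chainIdeal y (nilpotencyClass y - csmIndex y j)).subtype.restrictScalars K)).map
    ((Submodule.mkQ (Submodule.submoduleOf (chainIdeal y (nilpotencyClass y - csmIndex y j - 1))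
      (chainIdeal y (nilpotencyClass y - csmIndex y j)))).restrictScalars K)

end CentralSimple

/-! ### The polynomial rings, power sums and elementary symmetric polynomials -/

variable (K : Type*) [Field K] (n : ℕ)

/-- `R = K[x_1, …, x_n]`. -/
abbrev R : Type _ := MvPolynomial (Fin n) K

/-- `R[z] = K[x_1, …, x_n, z]`; the variable `x_i` is `X (some i)` and `z` is `X none`. -/
abbrev Rz : Type _ := MvPolynomial (Option (Fin n)) K

/-- The variable `z`. -/
def zVar : Rz K n := X none

/-- The `K`-algebra map `R[z] → R`, `x_i ↦ x_i`, `z ↦ 0`, through which `R`-modules are regarded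
as `R[z]`-modules on which `z` acts as zero. -/
def setZ : Rz K n →ₐ[K] R K n := aeval fun o : Option (Fin n) => o.elim 0 X

/-- The power sum `p_k = x_1 ^ k + ⋯ + x_n ^ k`. -/
def p (k : ℕ) : R K n := psum (Fin n) K k

/-- The elementary symmetric polynomial `e_k` of degree `k` with the sign `(-1) ^ k`, so that
`∏ (z - x_i) = ∑ e_k z ^ (n - k)`. -/
def e (k : ℕ) : R K n := (-1) ^ k * esymm (Fin n) K k

/-- `p_k + z ^ k` in `R[z]`. -/
def pTilde (k : ℕ) : Rz K n := rename some (p K n k) + zVar K n ^ k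

/-- The generators `p_a + z ^ a, …, p_{a+n} + z ^ (a+n)`, as a list. -/
def gens (a : ℕ) : List (Rz K n) := List.ofFn fun i : Fin (n + 1) => pTilde K n (a + i)

/-- The ideal of `R[z]` generated by `p_k + z ^ k` for `a ≤ k ≤ a + n`. -/
def idealI (a : ℕ) : Ideal (Rz K n) :=
  Ideal.span {f | ∃ k, a ≤ k ∧ k ≤ a + n ∧ f = pTilde K n k}

/-- The algebra `A = R[z] / I`. -/
abbrev A (a : ℕ) : Type _ := Rz K n ⧸ idealI K n a

/-- The image of `z` in `A`. -/
def zBar (a : ℕ) : A K n a := Ideal.Quotient.mk (idealI K n a) (zVar K n)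

/-- The standard grading of `A`. -/
def gradingA (a d : ℕ) : Submodule K (A K n a) :=
  (homogeneousSubmodule (Option (Fin n)) K d).map
    (Ideal.Quotient.mkₐ K (idealI K n a)).toLinearMap

/-- The ideal `(e_1, …, e_n)` of `R`. -/
def idealE : Ideal (R K n) := Ideal.span {f | ∃ k, 1 ≤ k ∧ k ≤ n ∧ f = e K n k}

/-- The ideal `(p_{a-1}, p_a, …, p_{a+j-3}, e_j, e_{j+1}, …, e_n)` of `R`, with `j - 1` power sums
and `n - j + 1` elementary symmetric polynomials; used for `a ≥ 2` and `1 ≤ j ≤ n + 1`. -/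
def idealJ (a j : ℕ) : Ideal (R K n) :=
  Ideal.span ({f | ∃ i, i < j - 1 ∧ f = p K n (a - 1 + i)} ∪
    {f | ∃ k, j ≤ k ∧ k ≤ n ∧ f = e K n k})

/-- The component of degree `d` of `R / J`. -/
def quotComponent (J : Ideal (R K n)) (d : ℕ) : Submodule K (R K n ⧸ J) :=
  (homogeneousSubmodule (Fin n) K d).map (Ideal.Quotient.mkₐ K J).toLinearMap

variable {K n}

/-- `R / J` is isomorphic to the central simple module `U_{j+1}` of `(A, z̄)` as a graded module,
up to a shift of the degrees. The isomorphism is `R[z]`-linear: `R[z]` acts on `R / J` through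
`z ↦ 0` and on `U_{j+1}` through `R[z] → A`. -/
def CSMIso {a : ℕ} (j : Fin (numCSM (zBar K n a))) (J : Ideal (R K n)) : Prop :=
  ∃ φ : (R K n ⧸ J) ≃ₗ[K] CSM (zBar K n a) j,
    (∀ (f : Rz K n) (m : R K n ⧸ J),
      φ (setZ K n f • m) = Ideal.Quotient.mk (idealI K n a) f • φ m) ∧
    ∃ s : ℕ, ∀ d : ℕ, (quotComponent K n J d).map φ.toLinearMap =
      csmComponent (gradingA K n a) (zBar K n a) j (d + s)

end PowerSumCI

end

/-! Let `G` be the polynomial `∑ e_i t ^ (s - i)` over `i ≤ s`, and `D_d` its Hasse derivative of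
order `s - d` at `z`. Modulo `e_{s+1}, …, e_n`, the product `∏ (t - x_i)` is `t ^ (n - s) G`; modulo
`D_{m+1}, …, D_s` also, `z` is a root of `G` of multiplicity at least `s - m`. A residue computation
(`psum_add_pow_eq`) then shows that, once `p̃_a, …, p̃_{a+m-1}` vanish too, `p̃_{a+m} = (s - m + 1)
z ^ a D_m`; this is `pTilde_sub_mem`.

Regularity is proved by induction on `n`, for all the sequences `p_a, …, p_{a+m-1}, e_{m+1}, …, e_n`
at once (`reg_baseSeq`). Setting `z = 0` turns `D_d` into `e_d`, so each such sequence lifts to a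
regular sequence modulo which `z` is a non-zero-divisor. Homogeneous regular sequences may be
permuted, and the congruence allows `p̃_{a+m}` to be exchanged for `D_{m+1}` step by step, starting
from `D_0 = 1`.

For `s = n` the same congruence computes `I : z ^ c`. Each division by `z ^ a` replaces `p̃_{a+m}`
by `D_m` (`pow_mul_mem_idealI`). After setting `z = 0`, the ideals `(0 : z̄ ^ c) + (z̄)` are
therefore constant on blocks of `a` consecutive exponents, with values `coneIdeal`. Only the jumps
between blocks can give central simple modules. Newton's identities give `p_{a+m} ≡ c e_{m+1}
p_{a-1}`, with `c` a unit, modulo the generators common to two neighbouring blocks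
(`exists_isUnit_p_sub_mem`). As `e_{m+1}` is a non-zero-divisor there, multiplication by it
identifies the jump with a quotient by `idealJ` (`mul_e_mem_coneIdeal`, `exists_quot_equiv`). For `a
= 1` the element `p_0 = n` is a unit, so only the first jump survives. -/

noncomputable section

namespace PowerSumCI

/-! ### Regular sequences, as multisets -/

section Regular

variable {S : Type*} [CommRing S]

/-- `x` is a non-zero-divisor modulo the ideal `Q`. -/
def NZD (Q : Ideal S) (x : S) : Prop := ∀ w, x * w ∈ Q → w ∈ Q

lemma NZD.of_isUnit (Q : Ideal S) {x : S} (hx : IsUnit x) : NZD Q x := fun _ hw =>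
  (Ideal.unit_mul_mem_iff_mem Q hx).1 hw

lemma NZD.mul {Q : Ideal S} {x y : S} (hx : NZD Q x) (hy : NZD Q y) : NZD Q (x * y) :=
  fun w hw => hy _ (hx _ (by rwa [← mul_assoc]))

lemma NZD.pow {Q : Ideal S} {x : S} (hx : NZD Q x) (k : ℕ) : NZD Q (x ^ k) := by
  induction k with
  | zero => exact fun w hw => by simpa using hw
  | succ k ih => rw [pow_succ]; exact ih.mul hx

lemma NZD.congr {Q : Ideal S} {x y : S} (hx : NZD Q x) (h : y - x ∈ Q) : NZD Q y := fun w hw =>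
  hx w (by
    have := Q.sub_mem hw (Q.mul_mem_right w h)
    rwa [← sub_mul, sub_sub_cancel] at this)

/-- The ideal generated by a multiset. -/
def mspan (s : Multiset S) : Ideal S := Ideal.span {y | y ∈ s}

lemma subset_mspan {s : Multiset S} {x : S} (h : x ∈ s) : x ∈ mspan s := Ideal.subset_span h

@[simp] lemma mspan_zero : mspan (0 : Multiset S) = ⊥ := by simp [mspan]

lemma mspan_cons (x : S) (s : Multiset S) : mspan (x ::ₘ s) = Ideal.span {x} ⊔ mspan s := by
  rw [mspan, mspan, ← Ideal.span_union]
  congr 1; ext y; simp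

lemma mspan_add (s t : Multiset S) : mspan (s + t) = mspan s ⊔ mspan t := by
  rw [mspan, mspan, mspan, ← Ideal.span_union]
  congr 1; ext y; simp

lemma mem_mspan_cons {x w : S} {s : Multiset S} :
    w ∈ mspan (x ::ₘ s) ↔ ∃ c, w - x * c ∈ mspan s := by
  rw [mspan_cons, Submodule.mem_sup]
  constructor
  · rintro ⟨y, hy, q, hq, rfl⟩
    obtain ⟨c, rfl⟩ := Ideal.mem_span_singleton'.1 hy
    exact ⟨c, by rwa [mul_comm c, add_sub_cancel_left]⟩
  · rintro ⟨c, hc⟩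
    exact ⟨x * c, Ideal.mul_mem_right _ _ (Ideal.mem_span_singleton_self x), _, hc, by ring⟩

lemma map_mspan {T : Type*} [CommRing T] (f : S →+* T) (s : Multiset S) :
    (mspan s).map f = mspan (s.map f) := by
  rw [mspan, mspan, Ideal.map_span]
  congr 1; ext y; simp

/-- The reverse of the list `l` is a weakly regular sequence. -/
def RegL : List S → Prop
  | [] => True
  | x :: l => RegL l ∧ NZD (mspan (l : Multiset S)) x

/-- Some ordering of the multiset `s` is a weakly regular sequence. -/
def Reg (s : Multiset S) : Prop := ∃ l : List S, (l : Multiset S) = s ∧ RegL l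

lemma RegL.isWeaklyRegular {l : List S} (h : RegL l) :
    RingTheory.Sequence.IsWeaklyRegular S l.reverse := by
  induction l with
  | nil => exact RingTheory.Sequence.IsWeaklyRegular.nil S S
  | cons x l ih =>
    rw [List.reverse_cons, RingTheory.Sequence.isWeaklyRegular_append_iff]
    refine ⟨ih h.1, ?_⟩
    rw [RingTheory.Sequence.isWeaklyRegular_singleton_iff]
    have key : (Ideal.ofList l.reverse • ⊤ : Submodule S S) = mspan (l : Multiset S) := by
      rw [mspan, Ideal.ofList]
      simp
    rw [key, isSMulRegular_iff_right_eq_zero_of_smul]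
    intro w
    obtain ⟨w, rfl⟩ := Submodule.mkQ_surjective _ w
    intro hw
    rw [← map_smul, Submodule.mkQ_apply, Submodule.Quotient.mk_eq_zero] at hw
    rw [Submodule.mkQ_apply, Submodule.Quotient.mk_eq_zero]
    exact h.2 w hw

lemma RegL.map {T : Type*} [CommRing T] (f : S ≃+* T) {l : List S} (h : RegL l) :
    RegL (l.map f) := by
  induction l with
  | nil => trivial
  | cons x l ih =>
    refine ⟨ih h.1, fun w hw => ?_⟩
    have e1 : mspan ((l.map f : List T) : Multiset T) = (mspan (l : Multiset S)).map (f : S →+* T) := by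
      rw [map_mspan]; rfl
    rw [e1] at hw ⊢
    have e2 : ∀ v, v ∈ (mspan (l : Multiset S)).map (f : S →+* T) ↔ f.symm v ∈ mspan (l : Multiset S) :=
      fun v => by rw [Ideal.map_comap_of_equiv]; exact Iff.rfl
    rw [e2] at hw ⊢
    exact h.2 _ (by simpa using hw)

end Regular

/-! ### Permuting and lifting homogeneous regular sequences -/

section Homogeneous

variable {σ K : Type*} [CommRing K]

/-- Homogeneous of positive degree. -/
def HomPos (f : MvPolynomial σ K) : Prop := ∃ d, f.IsHomogeneous (d + 1)

lemma IsHomogeneous.homPos {f : MvPolynomial σ K} {d : ℕ} (h : f.IsHomogeneous d) (hd : 1 ≤ d) :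
    HomPos f := ⟨d - 1, by rwa [Nat.sub_add_cancel hd]⟩

lemma homogeneousComponent_mem_mspan {s : Multiset (MvPolynomial σ K)} (hs : ∀ x ∈ s, HomPos x)
    {w : MvPolynomial σ K} (hw : w ∈ mspan s) (d : ℕ) :
    homogeneousComponent d w ∈ mspan s := by
  refine homogeneousComponent_mem_of_mem ?_ hw d
  let : GradedRing (homogeneousSubmodule σ K) := gradedAlgebra
  refine Ideal.homogeneous_span _ _ fun x hx => ?_
  obtain ⟨d, hd⟩ := hs x hx
  exact ⟨d + 1, hd⟩

lemma mem_mspan_of_homogeneousComponent {s : Multiset (MvPolynomial σ K)}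
    {w : MvPolynomial σ K} (hw : ∀ d, homogeneousComponent d w ∈ mspan s) : w ∈ mspan s := by
  rw [← sum_homogeneousComponent w]
  exact Ideal.sum_mem _ fun d _ => hw d

lemma homogeneousComponent_mul_of_lt {v c : MvPolynomial σ K} {k d : ℕ} (hv : v.IsHomogeneous k)
    (hd : d < k) : homogeneousComponent d (v * c) = 0 := by
  rw [← sum_homogeneousComponent c, Finset.mul_sum, map_sum]
  refine Finset.sum_eq_zero fun i _ => ?_
  rw [homogeneousComponent_of_mem (hv.mul (homogeneousComponent_isHomogeneous i c)), if_neg]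
  omega

/-- A graded form of Krull's intersection theorem: in degree `d`, a multiple of `v ^ (d + 1)`
contributes nothing. -/
lemma mem_mspan_of_forall_pow {s : Multiset (MvPolynomial σ K)} (hs : ∀ x ∈ s, HomPos x)
    {v w : MvPolynomial σ K} (hv : HomPos v) (h : ∀ k, ∃ c, w - v ^ k * c ∈ mspan s) :
    w ∈ mspan s := by
  refine mem_mspan_of_homogeneousComponent fun d => ?_
  obtain ⟨e, he⟩ := hv
  obtain ⟨c, hc⟩ := h (d + 1)
  have := homogeneousComponent_mem_mspan hs hc d
  rwa [map_sub, homogeneousComponent_mul_of_lt (he.pow (d + 1)), sub_zero] at this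
  nlinarith

/-- If `u w` lies in the ideal, dividing repeatedly by `v` puts `w` in the ideal plus `(v ^ k)` for
every `k`, and the graded intersection argument finishes. The second half is the usual syzygy chase
and uses no grading. -/
lemma NZD.swap {s : Multiset (MvPolynomial σ K)} (hs : ∀ x ∈ s, HomPos x)
    {u v : MvPolynomial σ K} (hv : HomPos v) (h1 : NZD (mspan s) v) (h2 : NZD (mspan (v ::ₘ s)) u) :
    NZD (mspan s) u ∧ NZD (mspan (u ::ₘ s)) v := by
  constructor
  · intro w hw
    refine mem_mspan_of_forall_pow hs hv fun k => ?_
    induction k with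
    | zero => exact ⟨w, by simp⟩
    | succ k ih =>
      obtain ⟨c, hc⟩ := ih
      have h3 : u * c ∈ mspan s := by
        refine h1.pow k _ ?_
        have := Ideal.sub_mem _ hw (Ideal.mul_mem_left _ u hc)
        convert this using 1; ring
      have h4 := h2 c (by rw [mspan_cons]; exact Ideal.mem_sup_right h3)
      obtain ⟨c', hc'⟩ := mem_mspan_cons.1 h4
      refine ⟨c', ?_⟩
      have := Ideal.add_mem _ hc (Ideal.mul_mem_left _ (v ^ k) hc')
      convert this using 1; ring
  · intro w hw
    obtain ⟨c, hc⟩ := mem_mspan_cons.1 hw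
    have h3 : c ∈ mspan (v ::ₘ s) := h2 c (mem_mspan_cons.2 ⟨w, by
      have := Ideal.neg_mem_iff _ |>.2 hc
      convert this using 1; ring⟩)
    obtain ⟨c', hc'⟩ := mem_mspan_cons.1 h3
    refine mem_mspan_cons.2 ⟨c', h1 _ ?_⟩
    have := Ideal.add_mem _ hc (Ideal.mul_mem_left _ u hc')
    convert this using 1; ring

lemma RegL.perm {l l' : List (MvPolynomial σ K)} (hp : l.Perm l') (hl : ∀ x ∈ l, HomPos x)
    (h : RegL l) : RegL l' := by
  induction hp with
  | nil => exact h
  | cons x hp ih =>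
    refine ⟨ih (fun y hy => hl y (List.mem_cons_of_mem _ hy)) h.1, ?_⟩
    rw [← Multiset.coe_eq_coe.2 hp]; exact h.2
  | swap x y l =>
    obtain ⟨⟨h1, h2⟩, h3⟩ := h
    rw [← Multiset.cons_coe] at h3
    have h4 : ∀ z ∈ (l : Multiset (MvPolynomial σ K)), HomPos z := fun z hz =>
      hl z (List.mem_cons_of_mem _ (List.mem_cons_of_mem _ (Multiset.mem_coe.1 hz)))
    have h5 : HomPos x := hl x (List.mem_cons_of_mem _ List.mem_cons_self)
    obtain ⟨h6, h7⟩ := NZD.swap h4 h5 h2 h3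
    rw [Multiset.cons_coe] at h7
    exact ⟨⟨h1, h6⟩, h7⟩
  | trans h1 h2 ih1 ih2 => exact ih2 (fun x hx => hl x (h1.mem_iff.2 hx)) (ih1 hl h)

lemma Reg.regL {l : List (MvPolynomial σ K)} (hl : ∀ x ∈ l, HomPos x)
    (h : Reg (l : Multiset (MvPolynomial σ K))) : RegL l := by
  obtain ⟨l', h1, h2⟩ := h
  have := Multiset.coe_eq_coe.1 h1
  exact h2.perm this fun x hx => hl x (this.mem_iff.1 hx)

lemma Reg.cons {S : Type*} [CommRing S] {x : S} {s : Multiset S} (h : Reg s)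
    (hx : NZD (mspan s) x) : Reg (x ::ₘ s) := by
  obtain ⟨l, rfl, h2⟩ := h
  exact ⟨x :: l, rfl, h2, hx⟩

/-- Permutability lets any chosen member be moved to the end of the sequence. All later exchange
arguments use this form. -/
lemma Reg.of_cons {x : MvPolynomial σ K} {s : Multiset (MvPolynomial σ K)}
    (hs : ∀ y ∈ x ::ₘ s, HomPos y) (h : Reg (x ::ₘ s)) : Reg s ∧ NZD (mspan s) x := by
  induction s using Quotient.inductionOn with
  | h l =>
    have := Reg.regL (l := x :: l) (fun y hy => hs y (by simpa using hy)) h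
    exact ⟨⟨l, rfl, this.1⟩, this.2⟩

lemma Reg.map_equiv {S T : Type*} [CommRing S] [CommRing T] (f : S ≃+* T) {s : Multiset S}
    (h : Reg s) : Reg (s.map f) := by
  obtain ⟨l, rfl, h⟩ := h
  exact ⟨l.map f, by simp, h.map f⟩

/-- If `f` is surjective with kernel generated by the non-zero-divisor `z`, regular sequences lift
along `f` to regular sequences after `z`. -/
lemma Reg.cons_of_map {S T : Type*} [CommRing S] [CommRing T] (f : S →+* T)
    (hf : Function.Surjective f) {z : S} (hk : RingHom.ker f = Ideal.span {z}) (hz : NZD ⊥ z)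
    {s : Multiset S} (h : ∃ l : List S, (l : Multiset S) = s ∧ RegL (l.map f)) :
    Reg (s + {z}) := by
  obtain ⟨l, rfl, h⟩ := h
  refine ⟨l ++ [z], rfl, ?_⟩
  induction l with
  | nil => exact ⟨trivial, by simpa using hz⟩
  | cons x l ih =>
    refine ⟨ih h.1, fun w hw => ?_⟩
    have key : mspan ((l ++ [z] : List S) : Multiset S) =
        (mspan ((l.map f : List T) : Multiset T)).comap f := by
      have e1 : mspan ((l.map f : List T) : Multiset T) = (mspan (l : Multiset S)).map f := by
        rw [map_mspan]; rfl
      rw [e1, Ideal.comap_map_of_surjective' f hf, hk, ← Multiset.coe_add, mspan_add]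
      congr 1
      simp [mspan]
    change w ∈ mspan ((l ++ [z] : List S) : Multiset S)
    change x * w ∈ mspan ((l ++ [z] : List S) : Multiset S) at hw
    rw [key, Ideal.mem_comap] at hw ⊢
    rw [map_mul] at hw
    exact h.2 _ hw

end Homogeneous

/-! ### Power sums of the roots of a polynomial with a multiple root -/

section Residue

open Polynomial hiding X C

variable {B : Type*} [CommRing B] {ι : Type*} [Fintype ι]

lemma degree_C_mul_le' (c : B) (P : Polynomial B) : (Polynomial.C c * P).degree ≤ P.degree := by
  rw [← Polynomial.smul_eq_C_mul]; exact degree_smul_le c P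

/-- The sum of the values of `h` at the roots of `F` is the residue of `h F' / F` at infinity. -/
lemma sum_eval_roots_eq (x : ι → B) (h P : Polynomial B) (c : B)
    (hP : P.degree < (Fintype.card ι : ℕ))
    (hd : (∏ i, (Polynomial.X - Polynomial.C (x i))) ∣
      h * derivative (∏ i, (Polynomial.X - Polynomial.C (x i))) - Polynomial.C c * P) :
    ∑ i, h.eval (x i) = c * P.coeff (Fintype.card ι - 1) := by
  classical
  nontriviality B
  set F : Polynomial B := ∏ i, (Polynomial.X - Polynomial.C (x i)) with hF
  have hFm : F.Monic := monic_prod_of_monic _ _ fun i _ => monic_X_sub_C _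
  have hFd : F.degree = (Fintype.card ι : ℕ) := by
    rw [hF, degree_prod_of_monic _ _ fun i _ => monic_X_sub_C _]
    simp
  let E : ι → Polynomial B := fun i => ∏ j ∈ Finset.univ.erase i, (Polynomial.X - Polynomial.C (x j))
  have hE : ∀ i, F = (Polynomial.X - Polynomial.C (x i)) * E i := fun i =>
    (Finset.mul_prod_erase _ _ (Finset.mem_univ i)).symm
  have hEm : ∀ i, (E i).Monic := fun i => monic_prod_of_monic _ _ fun i _ => monic_X_sub_C _
  have hEd : ∀ i, (E i).natDegree = Fintype.card ι - 1 := fun i => by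
    rw [natDegree_prod_of_monic _ _ fun i _ => monic_X_sub_C _]
    simp
  have hder : derivative F = ∑ i, E i := by
    rw [hF, derivative_prod_finset]
    exact Finset.sum_congr rfl fun i _ => by simp [E]
  -- Lagrange interpolation: `F'` is the sum of the `E i`, and `h * E i ≡ h(x i) * E i` modulo `F`
  -- because `F = (X - x i) * E i`.
  have h1 : F ∣ (∑ i, Polynomial.C (h.eval (x i)) * E i) - Polynomial.C c * P := by
    have h2 : F ∣ h * derivative F - ∑ i, Polynomial.C (h.eval (x i)) * E i := by
      rw [hder, Finset.mul_sum, ← Finset.sum_sub_distrib]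
      refine Finset.dvd_sum fun i _ => ?_
      rw [← sub_mul]
      obtain ⟨q, hq⟩ := X_sub_C_dvd_sub_C_eval (a := x i) (p := h)
      rw [hq, hE i]
      exact ⟨q, by ring⟩
    have := dvd_sub hd h2
    convert this using 1; ring
  have hlt : ((∑ i, Polynomial.C (h.eval (x i)) * E i) - Polynomial.C c * P).degree < F.degree := by
    rw [hFd]
    refine (degree_sub_le _ _).trans_lt (max_lt ?_ ?_)
    · refine (degree_sum_le _ _).trans_lt ?_
      rw [Finset.sup_lt_iff (by exact WithBot.bot_lt_coe _)]
      intro i _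
      refine lt_of_le_of_lt (degree_C_mul_le' _ _) ?_
      rw [degree_eq_natDegree (hEm i).ne_zero, hEd]
      have : 0 < Fintype.card ι := Fintype.card_pos_iff.2 ⟨i⟩
      exact_mod_cast (by omega)
    · exact lt_of_le_of_lt (degree_C_mul_le' _ _) hP
  -- `F` is monic, so a multiple of `F` of smaller degree vanishes even when `B` has zero divisors.
  have h3 : (∑ i, Polynomial.C (h.eval (x i)) * E i) - Polynomial.C c * P = 0 := by
    by_contra hne
    exact hFm.not_dvd_of_degree_lt hne hlt h1
  have h4 := congrArg (fun f => f.coeff (Fintype.card ι - 1)) (sub_eq_zero.1 h3)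
  simp only [finsetSum_coeff, Polynomial.coeff_C_mul] at h4
  rw [← h4]
  refine Finset.sum_congr rfl fun i _ => ?_
  have := (hEm i).coeff_natDegree
  rw [hEd] at this
  rw [this, mul_one]

/-- If `F = ∏ (t - x i)` has the factor `t - z` with multiplicity `k`, a power sum of the `x i`
and `z` is determined by the preceding ones. -/
lemma psum_add_pow_eq (x : ι → B) (z : B) (G : Polynomial B) (r m k a : ℕ) (ha : 1 ≤ a)
    (hG : G.Monic) (hdeg : G.natDegree = m + k)
    (hprod : ∏ i, (Polynomial.X - Polynomial.C (x i)) = Polynomial.X ^ r * G)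
    (hz : ∀ l < k, (hasseDeriv l G).eval z = 0)
    (hp : ∀ l < m, ∑ i, x i ^ (a + l) + z ^ (a + l) = 0) :
    ∑ i, x i ^ (a + m) + z ^ (a + m) = (k + 1) * z ^ a * (hasseDeriv k G).eval z := by
  nontriviality B
  obtain ⟨g, hg⟩ : (Polynomial.X - Polynomial.C z) ^ k ∣ G := by
    rw [X_sub_C_pow_dvd_iff, X_pow_dvd_iff]
    intro d hd
    have := hz d hd
    rwa [← taylor_coeff, taylor_apply] at this
  have hmk : ((Polynomial.X - Polynomial.C z) ^ k).Monic := (monic_X_sub_C z).pow k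
  have hgm : g.Monic := hmk.of_mul_monic_left (hg ▸ hG)
  have hgd : g.natDegree = m := by
    rw [hg, hmk.natDegree_mul hgm, (monic_X_sub_C z).natDegree_pow, natDegree_X_sub_C] at hdeg
    omega
  -- Expanding `G = (X - z) ^ k * g` around `z`, the coefficient of order `k` is `g(z)`.
  have hgz : (hasseDeriv k G).eval z = g.eval z := by
    rw [← taylor_coeff, hg, taylor_mul, taylor_pow, map_sub, taylor_X, taylor_C, add_sub_cancel_right,
      coeff_X_pow_mul', if_pos le_rfl, Nat.sub_self, taylor_coeff_zero]
  have hcard : Fintype.card ι = r + (m + k) := by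
    have := congrArg natDegree hprod
    rw [natDegree_prod_of_monic _ _ fun i _ => monic_X_sub_C _,
      (monic_X_pow r).natDegree_mul hG, hdeg] at this
    simpa using this
  -- Formally `F' / F = r / X + k / (X - z) + g' / g`. Multiplied by `h = X ^ a * g`, the first and
  -- last terms become polynomials (this needs `a ≥ 1`), and the middle one leaves the polar part `k
  -- z ^ a g(z) / (X - z)`. Hence `P = F / (X - z)`, which is available only for `k > 0`; for `k =
  -- 0` there is no polar part.
  have key : ∑ i, (Polynomial.X ^ a * g).eval (x i) = k * (z ^ a * g.eval z) := by
    obtain ⟨b, rfl⟩ : ∃ b, a = b + 1 := ⟨a - 1, by omega⟩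
    obtain ⟨q, hq⟩ := X_sub_C_dvd_sub_C_eval (a := z) (p := Polynomial.X ^ (b + 1) * g)
    have hX : Polynomial.X * derivative (Polynomial.X ^ r : Polynomial B) = (r : Polynomial B) * Polynomial.X ^ r := by
      cases r with
      | zero => simp
      | succ r => rw [derivative_X_pow_succ]; push_cast; simp only [map_add, map_natCast, map_one]; ring
    cases k with
    | zero =>
      rw [sum_eval_roots_eq x (Polynomial.X ^ (b + 1) * g) 0 0 (by simp)]
      · simp
      · rw [hprod, hg, pow_zero, one_mul, mul_zero, sub_zero, derivative_mul]
        refine ⟨(r : Polynomial B) * Polynomial.X ^ b * g + Polynomial.X ^ (b + 1) * derivative g, ?_⟩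
        linear_combination Polynomial.X ^ b * g * g * hX
    | succ k =>
      have hm1 : (Polynomial.X ^ r * ((Polynomial.X - Polynomial.C z) ^ k * g)).Monic :=
        (monic_X_pow r).mul (((monic_X_sub_C z).pow k).mul hgm)
      have hd1 : (Polynomial.X ^ r * ((Polynomial.X - Polynomial.C z) ^ k * g)).natDegree = Fintype.card ι - 1 := by
        rw [(monic_X_pow r).natDegree_mul (((monic_X_sub_C z).pow k).mul hgm),
          ((monic_X_sub_C z).pow k).natDegree_mul hgm, (monic_X_sub_C z).natDegree_pow,
          natDegree_X_sub_C, hgd, hcard, natDegree_X_pow]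
        omega
      have hc1 := hm1.coeff_natDegree
      rw [hd1] at hc1
      rw [sum_eval_roots_eq x (Polynomial.X ^ (b + 1) * g) (Polynomial.X ^ r * ((Polynomial.X - Polynomial.C z) ^ k * g))
        (((k + 1 : ℕ) : B) * (z ^ (b + 1) * g.eval z)) ?_ ?_, hc1, mul_one]
      · rw [degree_eq_natDegree hm1.ne_zero, hd1]
        exact_mod_cast (by omega)
      · rw [hprod, hg, derivative_mul, derivative_mul, derivative_X_sub_C_pow]
        refine ⟨(r : Polynomial B) * Polynomial.X ^ b * g + Polynomial.X ^ (b + 1) * derivative g + ((k + 1 : ℕ) : Polynomial B) * q, ?_⟩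
        simp only [Polynomial.eval_mul, Polynomial.eval_pow, Polynomial.eval_X] at hq
        simp only [map_mul, map_natCast, Nat.add_sub_cancel]
        simp only [map_mul] at hq
        linear_combination Polynomial.X ^ b * g * ((Polynomial.X - Polynomial.C z) ^ (k + 1) * g) * hX +
          ((k + 1 : ℕ) : Polynomial B) * Polynomial.X ^ r * ((Polynomial.X - Polynomial.C z) ^ k * g) * hq
  have hsum : ∀ y : B, (Polynomial.X ^ a * g).eval y = ∑ l ∈ Finset.range (m + 1), g.coeff l * y ^ (a + l) := by
    intro y
    rw [Polynomial.eval_mul, Polynomial.eval_pow, Polynomial.eval_X, eval_eq_sum_range, hgd, Finset.mul_sum]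
    exact Finset.sum_congr rfl fun l _ => by ring
  -- Since `g` is monic of degree `m`, its lower coefficients multiply power sums that vanish by
  -- assumption. The extra value at `z` later turns `k` into `k + 1`.
  have hfin : ∑ i, (Polynomial.X ^ a * g).eval (x i) + (Polynomial.X ^ a * g).eval z =
      ∑ i, x i ^ (a + m) + z ^ (a + m) := by
    simp_rw [hsum]
    rw [Finset.sum_comm, ← Finset.sum_add_distrib, Finset.sum_range_succ, Finset.sum_eq_zero]
    · have := hgm.coeff_natDegree
      rw [hgd] at this
      simp [this]
    · intro l hl
      rw [← Finset.mul_sum, ← mul_add, hp l (Finset.mem_range.1 hl), mul_zero]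
  rw [← hfin, key, hgz, Polynomial.eval_mul, Polynomial.eval_pow, Polynomial.eval_X]
  ring

end Residue

/-! ### Signed elementary symmetric polynomials and Newton's identities -/

section Symmetric

variable (σ K : Type*) [Fintype σ] [CommRing K]

/-- The signed elementary symmetric polynomial. -/
def es (k : ℕ) : MvPolynomial σ K := (-1) ^ k * esymm σ K k

lemma es_zero : es σ K 0 = 1 := by simp [es]

lemma es_eq_zero {k : ℕ} (hk : Fintype.card σ < k) : es σ K k = 0 := by
  rw [es, esymm, Finset.powersetCard_eq_empty.2 (by simpa using hk)]
  simp

lemma isHomogeneous_es (k : ℕ) : (es σ K k).IsHomogeneous k := by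
  have h1 : ((-1 : MvPolynomial σ K) ^ k).IsHomogeneous 0 := by
    have := (isHomogeneous_C σ ((-1 : K) ^ k))
    simpa using this
  have h2 : (esymm σ K k).IsHomogeneous k := by
    refine IsHomogeneous.sum _ _ _ fun t ht => ?_
    have := IsHomogeneous.prod t (fun i => (X i : MvPolynomial σ K)) (fun _ => 1)
      fun i _ => isHomogeneous_X K i
    simpa [(Finset.mem_powersetCard.1 ht).2] using this
  simpa [es] using h1.mul h2

lemma isHomogeneous_psum (k : ℕ) : (psum σ K k).IsHomogeneous k :=
  IsHomogeneous.sum _ _ _ fun i _ => isHomogeneous_X_pow i k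

lemma rename_es {τ : Type*} [Fintype τ] (f : σ ≃ τ) (k : ℕ) :
    rename f (es σ K k) = es τ K k := by
  simp [es, rename_esymm]

lemma prod_X_sub_C_eq : ∏ i : σ, (Polynomial.X - Polynomial.C (X i : MvPolynomial σ K)) =
    ∑ j ∈ Finset.range (Fintype.card σ + 1),
      Polynomial.monomial (Fintype.card σ - j) (es σ K j) := by
  have := Multiset.prod_X_sub_X_eq_sum_esymm (Finset.univ.val.map (X : σ → MvPolynomial σ K))
  rw [Multiset.map_map] at this
  simp only [Multiset.card_map, Finset.card_val, Finset.card_univ] at this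
  rw [Finset.prod]
  refine Eq.trans this (Finset.sum_congr rfl fun j _ => ?_)
  rw [← esymm_eq_multiset_esymm, ← Polynomial.C_mul_X_pow_eq_monomial, es]
  simp [mul_assoc]

lemma coeff_sum_monomial_sub {B : Type*} [Semiring B] (f : ℕ → B) {N k : ℕ} (hk : k ≤ N) :
    (∑ j ∈ Finset.range (N + 1), Polynomial.monomial (N - j) (f j)).coeff (N - k) = f k := by
  rw [Polynomial.finsetSum_coeff, Finset.sum_eq_single k]
  · simp
  · intro j hj hjk
    rw [Polynomial.coeff_monomial, if_neg]
    have := Finset.mem_range.1 hj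
    omega
  · intro h; exact absurd (Finset.mem_range.2 (by omega)) h

/-- Compare coefficients in `(t - z) ∏ (t - x_i)`. In the top case `e_{k+1}` is zero. -/
lemma es_option {k : ℕ} (hk : k ≤ Fintype.card σ) : es (Option σ) K (k + 1) =
    rename some (es σ K (k + 1)) - X none * rename some (es σ K k) := by
  have h1 := prod_X_sub_C_eq (Option σ) K
  rw [Fintype.prod_option, Fintype.card_option] at h1
  have h2 := congrArg (Polynomial.map (rename (R := K) (some : σ → Option σ)).toRingHom)
    (prod_X_sub_C_eq σ K)
  simp only [Polynomial.map_prod, Polynomial.map_sub, Polynomial.map_X, Polynomial.map_C,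
    Polynomial.map_sum, Polynomial.map_monomial, AlgHom.toRingHom_eq_coe, RingHom.coe_coe,
    rename_X] at h2
  rw [h2] at h1
  have h3 := congrArg (fun f => Polynomial.coeff f (Fintype.card σ + 1 - (k + 1))) h1
  rw [coeff_sum_monomial_sub _ (by omega)] at h3
  rw [← h3, sub_mul, Polynomial.coeff_sub, Polynomial.coeff_C_mul, Nat.add_sub_add_right,
    coeff_sum_monomial_sub _ hk]
  congr 1
  rcases hk.eq_or_lt with rfl | hk
  · rw [Nat.sub_self, Polynomial.mul_coeff_zero, Polynomial.coeff_X_zero, zero_mul,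
      es_eq_zero _ _ (Nat.lt_succ_self _), map_zero]
  · rw [show Fintype.card σ - k = Fintype.card σ - (k + 1) + 1 by omega, Polynomial.coeff_X_mul,
      coeff_sum_monomial_sub _ hk]

lemma psum_option (k : ℕ) : psum (Option σ) K k = rename some (psum σ K k) + X none ^ k := by
  simp [psum, Fintype.sum_option, add_comm]

/-- Newton's identity, with the signed elementary symmetric polynomials. -/
lemma sum_es_mul_psum (k : ℕ) :
    ∑ i ∈ Finset.range k, es σ K i * psum σ K (k - i) = - k * es σ K k := by
  have h := mul_esymm_eq_sum σ K k
  have h2 : ∑ a ∈ Finset.HasAntidiagonal.antidiagonal k with a.1 < k, (-1) ^ a.1 * esymm σ K a.1 * psum σ K a.2 =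
      ∑ i ∈ Finset.range k, es σ K i * psum σ K (k - i) := by
    rw [Finset.sum_filter, Finset.Nat.sum_antidiagonal_eq_sum_range_succ_mk, Finset.sum_range_succ]
    simp only [lt_irrefl, if_false, add_zero]
    exact Finset.sum_congr rfl fun i hi => by rw [if_pos (Finset.mem_range.1 hi)]; rfl
  rw [h2] at h
  have h3 : ((-1 : MvPolynomial σ K) ^ k) * (-1) ^ k = 1 := by rw [← mul_pow]; simp
  rw [es]
  linear_combination (-1 : MvPolynomial σ K) ^ k * h -
    (∑ i ∈ Finset.range k, es σ K i * psum σ K (k - i)) * h3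

end Symmetric

/-! ### Splitting intervals of indices -/

section Multisets

lemma Ioc_val_add {m s n : ℕ} (h1 : m ≤ s) (h2 : s ≤ n) :
    (Finset.Ioc s n).val + (Finset.Ioc m s).val = (Finset.Ioc m n).val := by
  refine (Multiset.Nodup.ext ?_ (Finset.nodup _)).2 fun a => ?_
  · refine Multiset.nodup_add.2 ⟨Finset.nodup _, Finset.nodup _, ?_⟩
    rw [Multiset.disjoint_left]
    intro a; simp; omega
  · simp; omega

lemma Ioc_val_succ {m s : ℕ} (h : m < s) :
    (Finset.Ioc m s).val = (m + 1) ::ₘ (Finset.Ioc (m + 1) s).val := by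
  refine (Multiset.Nodup.ext (Finset.nodup _) ?_).2 fun a => ?_
  · exact Multiset.nodup_cons.2 ⟨by simp, Finset.nodup _⟩
  · simp; omega

lemma Ioc_val_succ_right {m s : ℕ} (h : m ≤ s) :
    (Finset.Ioc m (s + 1)).val = (s + 1) ::ₘ (Finset.Ioc m s).val := by
  refine (Multiset.Nodup.ext (Finset.nodup _) ?_).2 fun a => ?_
  · exact Multiset.nodup_cons.2 ⟨by simp, Finset.nodup _⟩
  · simp; omega

end Multisets

/-! ### Lifting regular sequences to `R[z]`, and the key congruence -/

section SetZ

variable (K : Type*) [Field K] (n : ℕ)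

lemma setZ_rename (f : R K n) : setZ K n (rename some f) = f := by
  rw [setZ, aeval_rename]
  exact aeval_X_left_apply f

lemma setZ_zVar : setZ K n (zVar K n) = 0 := by simp [setZ, zVar]

lemma setZ_surjective : Function.Surjective (setZ K n) := fun f => ⟨_, setZ_rename K n f⟩

lemma sub_rename_setZ_mem (f : Rz K n) :
    f - rename some (setZ K n f) ∈ Ideal.span {zVar K n} := by
  rw [← Ideal.Quotient.eq]
  have : (Ideal.Quotient.mkₐ K (Ideal.span {zVar K n})) =
      (Ideal.Quotient.mkₐ K (Ideal.span {zVar K n})).comp ((rename some).comp (setZ K n)) := by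
    ext o
    cases o with
    | none =>
      simp only [AlgHom.comp_apply, setZ, aeval_X, Option.elim, map_zero]
      exact Ideal.Quotient.eq_zero_iff_mem.2 (Ideal.mem_span_singleton_self _)
    | some i => simp [setZ]
  exact DFunLike.congr_fun this f

lemma ker_setZ : RingHom.ker (setZ K n : Rz K n →+* R K n) = Ideal.span {zVar K n} := by
  ext f
  rw [RingHom.mem_ker]
  constructor
  · intro h
    have := sub_rename_setZ_mem K n f
    rw [RingHom.coe_coe] at h
    rwa [h, map_zero, sub_zero] at this
  · intro h
    obtain ⟨c, rfl⟩ := Ideal.mem_span_singleton'.1 h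
    simp [setZ_zVar]

lemma nzd_bot_zVar : NZD (⊥ : Ideal (Rz K n)) (zVar K n) := fun w hw => by
  simpa [zVar] using hw

lemma isHomogeneous_setZ {f : Rz K n} {d : ℕ} (hf : f.IsHomogeneous d) :
    (setZ K n f).IsHomogeneous d := by
  have := hf.aeval (fun o : Option (Fin n) => o.elim (0 : R K n) X) (n := 1) (fun o => by
    cases o
    · exact isHomogeneous_zero _ _ _
    · exact isHomogeneous_X _ _)
  rw [one_mul] at this
  exact this

lemma e_eq (k : ℕ) : e K n k = es (Fin n) K k := rfl

lemma p_eq (k : ℕ) : p K n k = psum (Fin n) K k := rfl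

lemma pTilde_eq (k : ℕ) : pTilde K n k = psum (Option (Fin n)) K k := (psum_option _ _ k).symm

lemma e_zero : e K n 0 = 1 := es_zero _ _

lemma e_eq_zero {k : ℕ} (hk : n < k) : e K n k = 0 := es_eq_zero _ _ (by simpa using hk)

lemma isHomogeneous_rename_e (k : ℕ) :
    (rename some (e K n k) : Rz K n).IsHomogeneous k :=
  (isHomogeneous_es (Fin n) K k).rename_isHomogeneous

lemma isHomogeneous_zVar : (zVar K n).IsHomogeneous 1 := isHomogeneous_X _ _

lemma isHomogeneous_pTilde (k : ℕ) : (pTilde K n k).IsHomogeneous k := by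
  rw [pTilde_eq]; exact isHomogeneous_psum _ _ k

/-- The divided derivative of order `s - d` of `∑ e_i t ^ (s - i)` at `t = z`. -/
def divDeriv (s d : ℕ) : Rz K n := ∑ i ∈ Finset.range (s + 1),
  ((s - i).choose (s - d) : Rz K n) * rename some (e K n i) * zVar K n ^ (d - i)

lemma eval_hasseDeriv_sum_monomial {B : Type*} [CommRing B] (f : ℕ → B) (y : B) {s d : ℕ}
    (hd : d ≤ s) : (Polynomial.hasseDeriv (s - d)
      (∑ i ∈ Finset.range (s + 1), Polynomial.monomial (s - i) (f i))).eval y =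
    ∑ i ∈ Finset.range (s + 1), ((s - i).choose (s - d) : B) * f i * y ^ (d - i) := by
  rw [map_sum, Polynomial.eval_finsetSum]
  refine Finset.sum_congr rfl fun i hi => ?_
  have := Finset.mem_range.1 hi
  rw [Polynomial.hasseDeriv_monomial, Polynomial.eval_monomial]
  rcases le_or_gt i d with h | h
  · rw [show s - i - (s - d) = d - i by omega]
  · rw [Nat.choose_eq_zero_of_lt (by omega)]; simp

lemma isHomogeneous_divDeriv {s d : ℕ} (hd : d ≤ s) : (divDeriv K n s d).IsHomogeneous d := by
  refine IsHomogeneous.sum _ _ _ fun i hi => ?_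
  have := Finset.mem_range.1 hi
  rcases le_or_gt i d with h | h
  · have h1 : ((((s - i).choose (s - d) : ℕ) : Rz K n)).IsHomogeneous 0 := by
      simpa using isHomogeneous_C (Option (Fin n)) (((s - i).choose (s - d) : ℕ) : K)
    have h2 := (h1.mul (isHomogeneous_rename_e K n i)).mul ((isHomogeneous_zVar K n).pow (d - i))
    rwa [show 0 + i + 1 * (d - i) = d by omega] at h2
  · rw [Nat.choose_eq_zero_of_lt (by omega)]
    simpa using isHomogeneous_zero _ _ _

/-- Terms with `i < d` carry a power of `z`, and those with `i > d` have binomial coefficient zero.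
Divided derivatives leave the coefficient 1 on the remaining term. -/
lemma setZ_divDeriv {s d : ℕ} (hd : d ≤ s) : setZ K n (divDeriv K n s d) = e K n d := by
  rw [divDeriv, map_sum, Finset.sum_eq_single d]
  · simp [setZ_rename]
  · intro i hi hid
    have := Finset.mem_range.1 hi
    rcases lt_or_gt_of_ne hid with h | h
    · rw [map_mul, map_pow, setZ_zVar, zero_pow (by omega), mul_zero]
    · rw [Nat.choose_eq_zero_of_lt (by omega)]; simp
  · intro h; exact absurd (Finset.mem_range.2 (by omega)) h

lemma divDeriv_zero (s : ℕ) : divDeriv K n s 0 = 1 := by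
  rw [divDeriv, Finset.sum_eq_single 0]
  · simp [e_zero]
  · intro i hi hid
    have := Finset.mem_range.1 hi
    rw [Nat.choose_eq_zero_of_lt (by omega)]; simp
  · simp

lemma setZ_pTilde {k : ℕ} (hk : 1 ≤ k) : setZ K n (pTilde K n k) = p K n k := by
  rw [pTilde, map_add, setZ_rename, map_pow, setZ_zVar, zero_pow (by omega), add_zero]

variable (a : ℕ)

/-- The sequence `p_a, …, p_{a+m-1}, e_{m+1}, …, e_n`, as a multiset. -/
def baseSeq (m : ℕ) : Multiset (R K n) :=
  (Finset.Ioc m n).val.map (e K n) + (Multiset.range m).map fun l => p K n (a + l)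

/-- A lift of `baseSeq` to `R[z]`. -/
def liftSeq (s m : ℕ) : Multiset (Rz K n) :=
  (Finset.Ioc s n).val.map (fun i => rename some (e K n i)) +
    (Finset.Ioc m s).val.map (divDeriv K n s) + (Multiset.range m).map fun l => pTilde K n (a + l)

variable {K n a}

lemma mem_liftSeq {s m : ℕ} {f : Rz K n} : f ∈ liftSeq K n a s m ↔
    (∃ i, s < i ∧ i ≤ n ∧ rename some (e K n i) = f) ∨
    (∃ d, m < d ∧ d ≤ s ∧ divDeriv K n s d = f) ∨ ∃ l < m, pTilde K n (a + l) = f := by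
  simp [liftSeq, and_assoc, or_assoc]

lemma homPos_liftSeq (ha : 1 ≤ a) {s m : ℕ} : ∀ f ∈ liftSeq K n a s m, HomPos f := by
  intro f hf
  rcases mem_liftSeq.1 hf with ⟨i, h1, _, rfl⟩ | ⟨d, h1, h2, rfl⟩ | ⟨l, _, rfl⟩
  · exact IsHomogeneous.homPos (isHomogeneous_rename_e K n i) (by omega)
  · exact IsHomogeneous.homPos (isHomogeneous_divDeriv K n h2) (by omega)
  · exact IsHomogeneous.homPos (isHomogeneous_pTilde K n _) (by omega)

lemma homPos_baseSeq (ha : 1 ≤ a) {m : ℕ} : ∀ f ∈ baseSeq K n a m, HomPos f := by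
  intro f hf
  simp only [baseSeq, Multiset.mem_add, Multiset.mem_map, Finset.mem_val, Finset.mem_Ioc,
    Multiset.mem_range] at hf
  rcases hf with ⟨i, h1, rfl⟩ | ⟨l, _, rfl⟩
  · exact IsHomogeneous.homPos (isHomogeneous_es _ K i) (by omega)
  · exact IsHomogeneous.homPos (isHomogeneous_psum _ K _) (by omega)

lemma map_setZ_liftSeq (ha : 1 ≤ a) {s m : ℕ} (h1 : m ≤ s) (h2 : s ≤ n) :
    (liftSeq K n a s m).map (setZ K n) = baseSeq K n a m := by
  rw [liftSeq, baseSeq, ← Ioc_val_add h1 h2]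
  simp only [Multiset.map_add, Multiset.map_map, Function.comp_def, setZ_rename]
  congr 1
  · congr 1
    exact Multiset.map_congr rfl fun d hd => setZ_divDeriv K n (by simp at hd; omega)
  · exact Multiset.map_congr rfl fun l _ => setZ_pTilde K n (by omega)

/-- Putting `z` first gives a regular sequence in `R[z]`; permutability then moves `z` to the end.
-/
lemma reg_of_map_setZ {s : Multiset (Rz K n)} {t : Multiset (R K n)}
    (hs : ∀ f ∈ s, HomPos f) (ht : ∀ f ∈ t, HomPos f)
    (hst : s.map (setZ K n) = t) (h : Reg t) : Reg s ∧ NZD (mspan s) (zVar K n) := by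
  obtain ⟨l, rfl⟩ := Quotient.exists_rep s
  have h1 := Reg.cons_of_map (setZ K n : Rz K n →+* R K n) (setZ_surjective K n) (ker_setZ K n)
    (nzd_bot_zVar K n) (s := l) ⟨l, rfl, by
      refine Reg.regL (fun x hx => ht x ?_) (by rw [← hst] at h; exact h)
      rw [← hst]; exact hx⟩
  rw [add_comm, Multiset.singleton_add] at h1
  refine h1.of_cons fun y hy => ?_
  rcases Multiset.mem_cons.1 hy with rfl | hy
  · exact IsHomogeneous.homPos (isHomogeneous_zVar K n) le_rfl
  · exact hs y hy

lemma reg_liftSeq (ha : 1 ≤ a) {s m : ℕ} (h1 : m ≤ s) (h2 : s ≤ n) (h : Reg (baseSeq K n a m)) :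
    Reg (liftSeq K n a s m) ∧ NZD (mspan (liftSeq K n a s m)) (zVar K n) :=
  reg_of_map_setZ (homPos_liftSeq ha) (homPos_baseSeq ha) (map_setZ_liftSeq ha h1 h2) h

/-- Modulo the ideal of `liftSeq`, the next power sum is a multiple of the next divided
derivative. -/
lemma pTilde_sub_mem (ha : 1 ≤ a) {s m : ℕ} (h1 : m ≤ s) (h2 : s ≤ n) :
    pTilde K n (a + m) - (((s - m : ℕ) : Rz K n) + 1) * zVar K n ^ a * divDeriv K n s m ∈
      mspan (liftSeq K n a s m) := by
  rw [← Ideal.Quotient.eq]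
  set q := Ideal.Quotient.mk (mspan (liftSeq K n a s m)) with hq
  nontriviality (Rz K n ⧸ mspan (liftSeq K n a s m))
  have hq0 : ∀ f ∈ liftSeq K n a s m, q f = 0 := fun f hf =>
    Ideal.Quotient.eq_zero_iff_mem.2 (subset_mspan hf)
  let f : ℕ → Rz K n ⧸ mspan (liftSeq K n a s m) := fun i => q (rename some (e K n i))
  set G := ∑ i ∈ Finset.range (s + 1), Polynomial.monomial (s - i) (f i) with hG
  have hGle : G.natDegree ≤ s := Polynomial.natDegree_sum_le_of_forall_le _ _ fun i _ =>
    (Polynomial.natDegree_monomial_le _).trans (Nat.sub_le _ _)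
  have hGc : G.coeff s = 1 := by
    have := coeff_sum_monomial_sub f (Nat.zero_le s)
    rw [Nat.sub_zero] at this
    rw [this]
    simp [f, e_zero]
  have hGd : G.natDegree = m + (s - m) := by
    rw [Polynomial.natDegree_eq_of_le_of_coeff_ne_zero hGle (by rw [hGc]; exact one_ne_zero)]
    omega
  have hGm : G.Monic := Polynomial.monic_of_natDegree_le_of_coeff_eq_one s hGle hGc
  have hD : ∀ d ≤ s, (Polynomial.hasseDeriv (s - d) G).eval (q (zVar K n)) =
      q (divDeriv K n s d) := by
    intro d hd
    rw [hG, eval_hasseDeriv_sum_monomial f _ hd, divDeriv]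
    simp [f]
  -- The coefficients `e_{s+1}, …, e_n` vanish in the quotient, so the product is divisible by `t ^
  -- (n - s)`.
  have hprod : ∏ i : Fin n, (Polynomial.X - Polynomial.C (q (X (some i)))) =
      Polynomial.X ^ (n - s) * G := by
    have := congrArg (Polynomial.map (q.comp (rename (R := K) (some : Fin n → Option _)).toRingHom))
      (prod_X_sub_C_eq (Fin n) K)
    simp only [Polynomial.map_prod, Polynomial.map_sub, Polynomial.map_X, Polynomial.map_C,
      Polynomial.map_sum, Polynomial.map_monomial, AlgHom.toRingHom_eq_coe, RingHom.coe_coe,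
      rename_X, RingHom.comp_apply, Fintype.card_fin] at this
    rw [this, hG, Finset.mul_sum]
    have hsub : Finset.range (s + 1) ⊆ Finset.range (n + 1) := Finset.range_mono (by omega)
    rw [← Finset.sum_subset hsub]
    · refine Finset.sum_congr rfl fun i hi => ?_
      have := Finset.mem_range.1 hi
      rw [mul_comm, Polynomial.monomial_mul_X_pow, show s - i + (n - s) = n - i by omega]
      rfl
    · intro i hi hi'
      have h3 := Finset.mem_range.1 hi
      have h4 : ¬ i < s + 1 := fun h => hi' (Finset.mem_range.2 h)
      rw [← e_eq, hq0 _ (mem_liftSeq.2 (Or.inl ⟨i, by omega, by omega, rfl⟩)),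
        Polynomial.monomial_zero_right]
  have hps : ∀ l, ∑ i : Fin n, q (X (some i)) ^ l + q (zVar K n) ^ l = q (pTilde K n l) := by
    intro l
    simp [pTilde, p, psum, map_sum]
  -- The multiplicity of the root `z` is taken to be `s - m`: the derivative of order `l < s - m` is
  -- `D_{s-l}`, and `s - l > m`.
  have := psum_add_pow_eq (fun i : Fin n => q (X (some i))) (q (zVar K n)) G (n - s) m (s - m) a ha
    hGm hGd hprod (fun l hl => by
      have := hD (s - l) (Nat.sub_le _ _)
      rw [Nat.sub_sub_self (by omega)] at this
      rw [this]
      exact hq0 _ (mem_liftSeq.2 (Or.inr (Or.inl ⟨s - l, by omega, by omega, rfl⟩))))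
    (fun l hl => by
      rw [hps]
      exact hq0 _ (mem_liftSeq.2 (Or.inr (Or.inr ⟨l, hl, rfl⟩))))
  rw [hps, hD m h1] at this
  rw [this]
  simp

/-- The exchange behind the induction: one multiset of `n + 1` elements, read either as `p̃_{a+m}`
over one lifted sequence or as `D_{m+1}` over the next. -/
lemma pTilde_cons_liftSeq {s m : ℕ} (h : m < s) :
    pTilde K n (a + m) ::ₘ liftSeq K n a s m =
      divDeriv K n s (m + 1) ::ₘ liftSeq K n a s (m + 1) := by
  rw [liftSeq, liftSeq, Ioc_val_succ h, Multiset.range_succ, Multiset.map_cons, Multiset.map_cons,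
    Multiset.add_cons, Multiset.add_cons, Multiset.cons_add, Multiset.cons_swap]

variable [CharZero K]

/-- Characteristic zero makes the factor `s - m + 1` of the key congruence invertible. -/
lemma isUnit_natCast_add_one (σ : Type*) (k : ℕ) : IsUnit ((k : MvPolynomial σ K) + 1) := by
  have h : ((k : K) + 1) ≠ 0 := by exact_mod_cast Nat.succ_ne_zero k
  simpa using (isUnit_iff_ne_zero.2 h).map (C : K →+* MvPolynomial σ K)

/-- The congruence passes the property from `D_m` to `p̃_{a+m}`, as `z` is a non-zero-divisor; the
exchange passes it on to `D_{m+1}`. The start is `D_0 = 1`. -/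
lemma nzd_divDeriv_pTilde (ha : 1 ≤ a) {s m : ℕ} (h1 : m ≤ s) (h2 : s ≤ n)
    (hT : ∀ m ≤ n, Reg (baseSeq K n a m)) :
    NZD (mspan (liftSeq K n a s m)) (divDeriv K n s m) ∧
      NZD (mspan (liftSeq K n a s m)) (pTilde K n (a + m)) := by
  suffices h : NZD (mspan (liftSeq K n a s m)) (divDeriv K n s m) by
    refine ⟨h, NZD.congr (((NZD.of_isUnit _ (isUnit_natCast_add_one _ _)).mul
      ((reg_liftSeq ha h1 h2 (hT m (h1.trans h2))).2.pow a)).mul h) (pTilde_sub_mem ha h1 h2)⟩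
  induction m with
  | zero => rw [divDeriv_zero]; exact NZD.of_isUnit _ isUnit_one
  | succ m ih =>
    have h3 : NZD (mspan (liftSeq K n a s m)) (pTilde K n (a + m)) :=
      NZD.congr (((NZD.of_isUnit _ (isUnit_natCast_add_one _ _)).mul
      ((reg_liftSeq ha (by omega) h2 (hT m (by omega))).2.pow a)).mul (ih (by omega)))
      (pTilde_sub_mem ha (by omega) h2)
    have h4 := (reg_liftSeq ha (by omega) h2 (hT m (by omega))).1.cons h3
    rw [pTilde_cons_liftSeq (by omega)] at h4
    refine (h4.of_cons fun y hy => ?_).2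
    rcases Multiset.mem_cons.1 hy with rfl | hy
    · exact IsHomogeneous.homPos (isHomogeneous_divDeriv K n h1) (by omega)
    · exact homPos_liftSeq ha y hy

end SetZ

/-! ### Regularity of mixed sequences, by induction on the number of variables -/

section Induction

variable {K : Type*} [Field K] {n a : ℕ}

/-- A sequence that interpolates between `liftSeq` and the sequence of power sums and elementary
symmetric polynomials in the variables of `R[z]`. -/
def mixSeq (K : Type*) [Field K] (n a m r : ℕ) : Multiset (Rz K n) :=
  (Finset.Ioc m r).val.map (es (Option (Fin n)) K) +
    (Finset.Ioc r n).val.map (fun i => rename some (e K n i)) +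
    (Multiset.range m).map fun l => pTilde K n (a + l)

lemma es_option_fin {k : ℕ} (hk : k ≤ n) : es (Option (Fin n)) K (k + 1) =
    rename some (e K n (k + 1)) - zVar K n * rename some (e K n k) :=
  es_option _ _ (by simpa using hk)

lemma mem_mixSeq {m r : ℕ} {f : Rz K n} : f ∈ mixSeq K n a m r ↔
    (∃ i, m < i ∧ i ≤ r ∧ es (Option (Fin n)) K i = f) ∨
    (∃ i, r < i ∧ i ≤ n ∧ rename some (e K n i) = f) ∨ ∃ l < m, pTilde K n (a + l) = f := by
  simp [mixSeq, and_assoc, or_assoc]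

lemma homPos_mixSeq (ha : 1 ≤ a) {m r : ℕ} : ∀ f ∈ mixSeq K n a m r, HomPos f := by
  intro f hf
  rcases mem_mixSeq.1 hf with ⟨i, h1, _, rfl⟩ | ⟨i, h1, h2, rfl⟩ | ⟨l, _, rfl⟩
  · exact IsHomogeneous.homPos (isHomogeneous_es _ K i) (by omega)
  · exact IsHomogeneous.homPos (isHomogeneous_rename_e K n i) (by omega)
  · exact IsHomogeneous.homPos (isHomogeneous_pTilde K n _) (by omega)

lemma reg_mixSeq (ha : 1 ≤ a) {m r : ℕ} (h1 : m ≤ r) (h2 : r ≤ n) (h : Reg (baseSeq K n a m)) :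
    Reg (mixSeq K n a m r) ∧ NZD (mspan (mixSeq K n a m r)) (zVar K n) := by
  refine reg_of_map_setZ (homPos_mixSeq ha) (homPos_baseSeq ha) ?_ h
  rw [mixSeq, baseSeq, ← Ioc_val_add h1 h2]
  simp only [Multiset.map_add, Multiset.map_map, Function.comp_def, setZ_rename]
  rw [add_comm (Multiset.map _ (Finset.Ioc m r).val)]
  congr 1
  · congr 1
    refine Multiset.map_congr rfl fun d hd => ?_
    simp only [Finset.mem_val, Finset.mem_Ioc] at hd
    obtain ⟨k, rfl⟩ : ∃ k, d = k + 1 := ⟨d - 1, by omega⟩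
    rw [es_option_fin (by omega), map_sub, map_mul, setZ_zVar, setZ_rename, zero_mul, sub_zero]
  · exact Multiset.map_congr rfl fun l _ => setZ_pTilde K n (by omega)

lemma mixSeq_self (m : ℕ) : mixSeq K n a m m = liftSeq K n a m m := by
  simp [mixSeq, liftSeq]

/-- An exchange with `s = m`, where no derivative occurs: `p̃_{a+m}` is traded for `e_{m+1}` and `s`
moves up together with `m`. -/
lemma liftSeq_self_cons {m : ℕ} (h : m + 1 ≤ n) :
    pTilde K n (a + m) ::ₘ liftSeq K n a m m =
      rename some (e K n (m + 1)) ::ₘ liftSeq K n a (m + 1) (m + 1) := by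
  simp only [liftSeq, Finset.Ioc_self, Finset.empty_val, Multiset.map_zero, add_zero]
  rw [Ioc_val_succ (show m < n by omega), Multiset.range_succ, Multiset.map_cons, Multiset.map_cons,
    Multiset.add_cons, Multiset.cons_add, Multiset.cons_swap]

lemma mixSeq_cons {m r : ℕ} (h1 : m ≤ r) (h2 : r + 1 ≤ n) :
    es (Option (Fin n)) K (r + 1) ::ₘ mixSeq K n a m r =
      rename some (e K n (r + 1)) ::ₘ mixSeq K n a m (r + 1) := by
  simp only [mixSeq]
  rw [Ioc_val_succ (show r < n by omega), Ioc_val_succ_right h1, Multiset.map_cons,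
    Multiset.map_cons, Multiset.add_cons, Multiset.cons_add, Multiset.cons_add, Multiset.cons_add,
    Multiset.cons_swap]

variable [CharZero K]

/-- Modulo the sequence `e_{r+1}` vanishes, so `ẽ_{r+1} = e_{r+1} - z e_r` reduces to `-z e_r`.
Exchanging `ẽ_{r+1}` with `e_{r+1}` moves `r` up by one; the start `r = m` comes from the power sum
exchange. -/
lemma nzd_mixSeq (ha : 1 ≤ a) (hT : ∀ m ≤ n, Reg (baseSeq K n a m)) {m r : ℕ} (h1 : m ≤ r)
    (h2 : r ≤ n) : NZD (mspan (mixSeq K n a m r)) (rename some (e K n r)) ∧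
      NZD (mspan (mixSeq K n a m r)) (es (Option (Fin n)) K (r + 1)) := by
  suffices h : NZD (mspan (mixSeq K n a m r)) (rename some (e K n r)) by
    refine ⟨h, NZD.congr (((NZD.of_isUnit _ isUnit_one.neg).mul
      (reg_mixSeq ha h1 h2 (hT m (by omega))).2).mul h) ?_⟩
    have h3 : rename some (e K n (r + 1)) ∈ mspan (mixSeq K n a m r) := by
      rcases h2.eq_or_lt with rfl | h2
      · rw [e_eq_zero K r (Nat.lt_succ_self r), map_zero]; exact Ideal.zero_mem _
      · exact subset_mspan (mem_mixSeq.2 (Or.inr (Or.inl ⟨r + 1, by omega, by omega, rfl⟩)))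
    rw [es_option_fin h2]
    convert h3 using 1; ring
  induction r, h1 using Nat.le_induction with
  | base =>
    cases m with
    | zero => rw [e_zero, map_one]; exact NZD.of_isUnit _ isUnit_one
    | succ m =>
      have h3 := (reg_liftSeq ha le_rfl (by omega) (hT m (by omega))).1.cons
        (nzd_divDeriv_pTilde ha le_rfl (by omega) hT).2
      rw [liftSeq_self_cons h2] at h3
      rw [mixSeq_self]
      refine (h3.of_cons fun y hy => ?_).2
      rcases Multiset.mem_cons.1 hy with rfl | hy
      · exact IsHomogeneous.homPos (isHomogeneous_rename_e K n _) (by omega)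
      · exact homPos_liftSeq ha y hy
  | succ r h1 ih =>
    have h3 : NZD (mspan (mixSeq K n a m r)) (es (Option (Fin n)) K (r + 1)) := by
      refine NZD.congr (((NZD.of_isUnit _ isUnit_one.neg).mul
        (reg_mixSeq ha h1 (by omega) (hT m (by omega))).2).mul (ih (by omega))) ?_
      have h3 : rename some (e K n (r + 1)) ∈ mspan (mixSeq K n a m r) :=
        subset_mspan (mem_mixSeq.2 (Or.inr (Or.inl ⟨r + 1, by omega, by omega, rfl⟩)))
      rw [es_option_fin (by omega)]
      convert h3 using 1; ring
    have h4 := (reg_mixSeq ha h1 (by omega) (hT m (by omega))).1.cons h3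
    rw [mixSeq_cons h1 h2] at h4
    refine (h4.of_cons fun y hy => ?_).2
    rcases Multiset.mem_cons.1 hy with rfl | hy
    · exact IsHomogeneous.homPos (isHomogeneous_rename_e K n _) (by omega)
    · exact homPos_mixSeq ha y hy

lemma reg_psum_option (ha : 1 ≤ a) (hT : ∀ m ≤ n, Reg (baseSeq K n a m)) :
    Reg ((Multiset.range (n + 1)).map fun l => pTilde K n (a + l)) := by
  have h3 := (reg_liftSeq ha le_rfl le_rfl (hT n le_rfl)).1.cons
    (nzd_divDeriv_pTilde ha le_rfl le_rfl hT).2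
  simpa [liftSeq] using h3

lemma reg_option (ha : 1 ≤ a) (hT : ∀ m ≤ n, Reg (baseSeq K n a m)) {m : ℕ} (hm : m ≤ n + 1) :
    Reg ((Finset.Ioc m (n + 1)).val.map (es (Option (Fin n)) K) +
      (Multiset.range m).map fun l => psum (Option (Fin n)) K (a + l)) := by
  simp only [← pTilde_eq]
  rcases hm.eq_or_lt with rfl | hm
  · simpa using reg_psum_option ha hT
  · have := (reg_mixSeq ha (Nat.lt_succ_iff.1 hm) le_rfl (hT m (by omega))).1.cons
      (nzd_mixSeq ha hT (by omega) le_rfl).2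
    rw [Ioc_val_succ_right (by omega), Multiset.map_cons, Multiset.cons_add]
    simpa [mixSeq] using this

/-- The new variable of `n + 1` variables plays the role of `z`, so all the sequences in `n`
variables together give those in `n + 1`. -/
lemma reg_baseSeq (ha : 1 ≤ a) {m : ℕ} (hm : m ≤ n) : Reg (baseSeq K n a m) := by
  induction n generalizing m with
  | zero =>
    obtain rfl : m = 0 := by omega
    exact ⟨[], by simp [baseSeq], trivial⟩
  | succ n ih =>
    have h := (reg_option (K := K) ha (fun m hm => ih hm) hm).map_equiv
      (renameEquiv K (finSuccEquiv n).symm).toRingEquiv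
    have h1 : ∀ k, rename (finSuccEquiv n).symm (es (Option (Fin n)) K k) = e K (n + 1) k :=
      fun k => rename_es _ _ _ k
    have h2 : ∀ k, rename (finSuccEquiv n).symm (psum (Option (Fin n)) K k) = p K (n + 1) k :=
      fun k => rename_psum _ _ k _
    rw [baseSeq]
    convert h using 1
    simp [Multiset.map_map, h1, h2]

end Induction

/-! ### The colon ideals `I : z ^ c` -/

section Chain

variable {K : Type*} [Field K] {n a : ℕ}

lemma HomPos.constantCoeff_eq_zero {σ K : Type*} [CommRing K] {f : MvPolynomial σ K}
    (hf : HomPos f) : constantCoeff f = 0 := by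
  obtain ⟨d, hd⟩ := hf
  rw [constantCoeff_eq]
  exact hd.coeff_eq_zero (by simp)

lemma span_ne_top_of_homPos {σ K : Type*} [CommRing K] [Nontrivial K]
    {s : Set (MvPolynomial σ K)} (hs : ∀ f ∈ s, HomPos f) : Ideal.span s ≠ ⊤ := by
  intro h
  have h1 : Ideal.span s ≤ RingHom.ker (constantCoeff : MvPolynomial σ K →+* K) :=
    Ideal.span_le.2 fun f hf => (hs f hf).constantCoeff_eq_zero
  have h2 := h1 (h ▸ Submodule.mem_top : (1 : MvPolynomial σ K) ∈ Ideal.span s)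
  simp [RingHom.mem_ker] at h2

/-- The ideal `(z ^ t D_m) + (liftSeq)`, where `D_m` is the next divided derivative. -/
def stepIdeal (K : Type*) [Field K] (n a m t : ℕ) : Ideal (Rz K n) :=
  mspan ((zVar K n ^ t * divDeriv K n n m) ::ₘ liftSeq K n a n m)

lemma mspan_cons_congr {S : Type*} [CommRing S] {s : Multiset S} {x y c : S} (hc : IsUnit c)
    (h : x - c * y ∈ mspan s) : mspan (x ::ₘ s) = mspan (y ::ₘ s) := by
  obtain ⟨c, rfl⟩ := hc
  ext w
  rw [mem_mspan_cons, mem_mspan_cons]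
  constructor
  · rintro ⟨d, hd⟩
    refine ⟨c * d, ?_⟩
    have := Ideal.add_mem _ hd (Ideal.mul_mem_right d _ h)
    convert this using 1; ring
  · rintro ⟨d, hd⟩
    refine ⟨↑c⁻¹ * d, ?_⟩
    have := Ideal.sub_mem _ hd (Ideal.mul_mem_right (↑c⁻¹ * d) _ h)
    convert this using 1
    linear_combination -(y * d) * c.mul_inv

lemma mem_stepIdeal_zero (w : Rz K n) : w ∈ stepIdeal K n a 0 0 := by
  have : (1 : Rz K n) ∈ stepIdeal K n a 0 0 :=
    subset_mspan (by rw [divDeriv_zero, pow_zero, mul_one]; exact Multiset.mem_cons_self _ _)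
  simpa using Ideal.mul_mem_left _ w this

lemma map_stepIdeal (ha : 1 ≤ a) {m t : ℕ} (hm : m ≤ n) (ht : 1 ≤ t) :
    (stepIdeal K n a m t).map (setZ K n : Rz K n →+* R K n) = mspan (baseSeq K n a m) := by
  rw [stepIdeal, map_mspan, Multiset.map_cons]
  have : (liftSeq K n a n m).map (setZ K n : Rz K n →+* R K n) = baseSeq K n a m :=
    map_setZ_liftSeq ha hm le_rfl
  rw [this, mspan_cons]
  simp [setZ_zVar, zero_pow (show t ≠ 0 by omega)]

/-- With `J = I : z ^ c`, the chain ideal is the image of `J + (z)`. It contains `z̄`, so membership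
can be tested in `R` after setting `z = 0`. -/
lemma mk_mem_chainIdeal (c : ℕ) (J : Ideal (Rz K n))
    (hJ : ∀ w, zVar K n ^ c * w ∈ idealI K n a ↔ w ∈ J) (f : Rz K n) :
    Ideal.Quotient.mk (idealI K n a) f ∈ chainIdeal (zBar K n a) c ↔
      setZ K n f ∈ J.map (setZ K n : Rz K n →+* R K n) := by
  have hIJ : idealI K n a ≤ J := fun w hw => (hJ w).1 (Ideal.mul_mem_left _ _ hw)
  have h1 : chainIdeal (zBar K n a) c =
      (J ⊔ Ideal.span {zVar K n}).map (Ideal.Quotient.mk (idealI K n a)) := by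
    rw [chainIdeal, Ideal.map_sup, Ideal.map_span, Set.image_singleton]
    congr 1
    ext w
    obtain ⟨w, rfl⟩ := Ideal.Quotient.mk_surjective w
    rw [Submodule.mem_colon_singleton, zBar, ← map_pow, smul_eq_mul, ← map_mul, Ideal.mem_bot,
      Ideal.Quotient.eq_zero_iff_mem, mul_comm, hJ, Ideal.mem_quotient_iff_mem hIJ]
  rw [h1, Ideal.mem_quotient_iff_mem (hIJ.trans le_sup_left)]
  have h2 := Ideal.comap_map_of_surjective' (setZ K n : Rz K n →+* R K n) (setZ_surjective K n) J
  rw [ker_setZ] at h2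
  rw [← h2]
  rfl

variable [CharZero K]

lemma mspan_pTilde_cons (ha : 1 ≤ a) {m : ℕ} (hm : m ≤ n) :
    mspan (pTilde K n (a + m) ::ₘ liftSeq K n a n m) = stepIdeal K n a m a :=
  mspan_cons_congr (isUnit_natCast_add_one _ (n - m))
    (by rw [← mul_assoc]; exact pTilde_sub_mem ha hm le_rfl)

lemma idealI_eq (ha : 1 ≤ a) : idealI K n a = stepIdeal K n a n a := by
  rw [← mspan_pTilde_cons ha le_rfl]
  have : pTilde K n (a + n) ::ₘ liftSeq K n a n n =
      (Multiset.range (n + 1)).map fun l => pTilde K n (a + l) := by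
    simp [liftSeq]
  rw [this, idealI, mspan]
  congr 1
  ext f
  simp only [Set.mem_ofPred_eq, Multiset.mem_map, Multiset.mem_range]
  constructor
  · rintro ⟨k, h1, h2, rfl⟩
    exact ⟨k - a, by omega, by rw [Nat.add_sub_cancel' h1]⟩
  · rintro ⟨l, h1, rfl⟩
    exact ⟨a + l, by omega, by omega, rfl⟩

/-- Both are generated by `p̃_{a+m}` and the lifted sequence, by the key congruence and the
exchange. Thus a division that removes the whole factor `z ^ a` lands at the top of the next step.
-/
lemma stepIdeal_succ_zero (ha : 1 ≤ a) {m : ℕ} (hm : m < n) :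
    stepIdeal K n a (m + 1) 0 = stepIdeal K n a m a := by
  rw [← mspan_pTilde_cons ha hm.le, pTilde_cons_liftSeq hm, stepIdeal, pow_zero, one_mul]

lemma pow_mul_mem_stepIdeal (ha : 1 ≤ a) {m r t : ℕ} (hm : m ≤ n) (w : Rz K n) :
    zVar K n ^ r * w ∈ stepIdeal K n a m (r + t) ↔ w ∈ stepIdeal K n a m t := by
  have hz := (reg_liftSeq ha hm le_rfl (reg_baseSeq (K := K) ha hm)).2
  rw [stepIdeal, stepIdeal, mem_mspan_cons, mem_mspan_cons]
  refine exists_congr fun c => ?_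
  have h1 : zVar K n ^ r * w - zVar K n ^ (r + t) * divDeriv K n n m * c =
    zVar K n ^ r * (w - zVar K n ^ t * divDeriv K n n m * c) := by ring
  rw [h1]
  exact ⟨hz.pow r _, Ideal.mul_mem_left _ _⟩

lemma pow_mul_mem_idealI_of_dvd (ha : 1 ≤ a) {k : ℕ} (hk : k ≤ n) (w : Rz K n) :
    zVar K n ^ (a * k) * w ∈ idealI K n a ↔ w ∈ stepIdeal K n a (n - k) a := by
  induction k generalizing w with
  | zero => rw [idealI_eq ha]; simp
  | succ k ih =>
    rw [mul_add, mul_one, pow_add, mul_assoc, ih (by omega)]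
    have := pow_mul_mem_stepIdeal (r := a) (t := 0) ha (Nat.sub_le n k) w
    rw [add_zero] at this
    rw [this, show n - k = n - (k + 1) + 1 by omega, stepIdeal_succ_zero ha (by omega)]

/-- Each full `a` in `c` descends one step; the remainder `c % a` only lowers the power of `z` in
front of the derivative. -/
lemma pow_mul_mem_idealI (ha : 1 ≤ a) {c : ℕ} (hc : c < a * (n + 1)) (w : Rz K n) :
    zVar K n ^ c * w ∈ idealI K n a ↔ w ∈ stepIdeal K n a (n - c / a) (a - c % a) := by
  have h1 : c / a ≤ n := Nat.lt_succ_iff.1 (Nat.div_lt_of_lt_mul hc)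
  have h2 : c % a < a := Nat.mod_lt _ ha
  conv_lhs => rw [← Nat.div_add_mod c a, pow_add, mul_assoc, pow_mul_mem_idealI_of_dvd ha h1]
  have := pow_mul_mem_stepIdeal (r := c % a) (t := a - c % a) ha (Nat.sub_le n (c / a)) w
  rwa [Nat.add_sub_cancel' h2.le] at this

lemma pow_mem_idealI (ha : 1 ≤ a) : zVar K n ^ (a * (n + 1)) ∈ idealI K n a := by
  have h := pow_mul_mem_idealI_of_dvd (K := K) (n := n) ha le_rfl (zVar K n ^ a)
  rw [← pow_add, Nat.sub_self] at h
  rw [mul_add, mul_one, h]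
  have := pow_mul_mem_stepIdeal (K := K) (n := n) (m := 0) (r := a) (t := 0) ha (Nat.zero_le _) 1
  rw [mul_one, add_zero] at this
  exact this.2 (mem_stepIdeal_zero 1)

/-- The ideal `(p_a, …, p_{a+j-2}, e_j, …, e_n)`, which is the unit ideal for `j = 0`. -/
def coneIdeal (K : Type*) [Field K] (n a : ℕ) : ℕ → Ideal (R K n)
  | 0 => ⊤
  | j + 1 => mspan (baseSeq K n a j)

/-- The chain is constant on blocks of length `a`: while a positive power of `z` multiplies the
derivative, that generator dies at `z = 0`. The block `j = 0` begins at the nilpotency exponent. -/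
lemma mk_mem_chainIdeal_iff (ha : 1 ≤ a) {c j : ℕ} (hj : j ≤ n + 1) (hc1 : c < a * (n + 2 - j))
    (hc2 : a * (n + 1 - j) ≤ c) (f : Rz K n) :
    Ideal.Quotient.mk (idealI K n a) f ∈ chainIdeal (zBar K n a) c ↔
      setZ K n f ∈ coneIdeal K n a j := by
  cases j with
  | zero =>
    rw [mk_mem_chainIdeal c ⊤ (fun w => ?_), Ideal.map_top]
    · rfl
    · simp only [Submodule.mem_top, iff_true]
      refine Ideal.mul_mem_right _ _ ?_
      rw [← Nat.sub_add_cancel hc2, pow_add]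
      exact Ideal.mul_mem_left _ _ (pow_mem_idealI ha)
  | succ j =>
    have h0 : c / a = n - j := by
      rw [Nat.div_eq_iff (by omega)]
      rw [show n + 2 - (j + 1) = n - j + 1 by omega, mul_add, mul_one] at hc1
      rw [show n + 1 - (j + 1) = n - j by omega] at hc2
      rw [mul_comm]
      omega
    have h1 : c < a * (n + 1) := hc1.trans_le (Nat.mul_le_mul_left _ (by omega))
    have h2 : c % a < a := Nat.mod_lt _ ha
    rw [mk_mem_chainIdeal c _ (pow_mul_mem_idealI ha h1), map_stepIdeal ha (by omega) (by omega),
      h0, Nat.sub_sub_self (by omega)]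
    rfl

lemma nilpotencyClass_zBar (ha : 1 ≤ a) : nilpotencyClass (zBar K n a) = a * (n + 1) := by
  have hpos : 0 < a * (n + 1) := Nat.mul_pos ha (Nat.succ_pos n)
  obtain ⟨k, hk⟩ : ∃ k, a * (n + 1) = k + 1 := ⟨a * (n + 1) - 1, by omega⟩
  rw [hk, nilpotencyClass_eq_succ_iff]
  simp only [zBar, ← map_pow]
  rw [Ne, Ideal.Quotient.eq_zero_iff_mem, Ideal.Quotient.eq_zero_iff_mem]
  refine ⟨hk ▸ pow_mem_idealI ha, fun h => ?_⟩
  have h1 := pow_mul_mem_idealI (K := K) ha (show k < a * (n + 1) by omega) 1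
  rw [mul_one] at h1
  -- If `z ^ k` were in `I`, the image of `I : z ^ k` in `R` would contain 1, although its
  -- generators have positive degree.
  have h2 := Ideal.mem_map_of_mem (setZ K n : Rz K n →+* R K n) (h1.1 h)
  rw [map_stepIdeal ha (Nat.sub_le _ _) (by have := Nat.mod_lt k ha; omega), map_one] at h2
  exact span_ne_top_of_homPos (homPos_baseSeq ha) ((Ideal.eq_top_iff_one _).2 h2)

end Chain

/-! ### Successive quotients of the ideals in `R` -/

section Cone

variable {K : Type*} [Field K] {n a : ℕ}

/-- The common part of `baseSeq` for `m` and `m + 1`. -/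
def coreSeq (K : Type*) [Field K] (n a m : ℕ) : Multiset (R K n) :=
  (Finset.Ioc (m + 1) n).val.map (e K n) + (Multiset.range m).map fun l => p K n (a + l)

lemma baseSeq_eq_e_cons {m : ℕ} (hm : m < n) :
    baseSeq K n a m = e K n (m + 1) ::ₘ coreSeq K n a m := by
  rw [baseSeq, coreSeq, Ioc_val_succ hm, Multiset.map_cons, Multiset.cons_add]

lemma baseSeq_succ_eq_p_cons (m : ℕ) :
    baseSeq K n a (m + 1) = p K n (a + m) ::ₘ coreSeq K n a m := by
  rw [baseSeq, coreSeq, Multiset.range_succ, Multiset.map_cons, Multiset.add_cons]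

lemma idealJ_succ_succ (ha : 1 ≤ a) (m : ℕ) :
    idealJ K n a (m + 2) = mspan (p K n (a - 1) ::ₘ coreSeq K n a m) := by
  rw [idealJ, mspan]
  congr 1
  ext f
  simp only [coreSeq, Set.mem_union, Set.mem_ofPred_eq, Multiset.mem_cons, Multiset.mem_add,
    Multiset.mem_map, Finset.mem_val, Finset.mem_Ioc, Multiset.mem_range]
  constructor
  · rintro (⟨i, hi, rfl⟩ | ⟨k, h1, h2, rfl⟩)
    · cases i with
      | zero => exact Or.inl rfl
      | succ i => exact Or.inr (Or.inr ⟨i, by omega, by rw [show a - 1 + (i + 1) = a + i by omega]⟩)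
    · exact Or.inr (Or.inl ⟨k, ⟨by omega, h2⟩, rfl⟩)
  · rintro (rfl | ⟨k, ⟨h1, h2⟩, rfl⟩ | ⟨l, hl, rfl⟩)
    · exact Or.inl ⟨0, by omega, rfl⟩
    · exact Or.inr ⟨k, by omega, h2, rfl⟩
    · exact Or.inl ⟨l + 1, by omega, by rw [show a - 1 + (l + 1) = a + l by omega]⟩

lemma idealJ_one : idealJ K n a 1 = idealE K n := by
  simp [idealJ, idealE]

lemma idealE_eq : idealE K n = mspan (baseSeq K n a 0) := by
  rw [idealE, mspan]
  congr 1
  ext f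
  simp only [baseSeq, Set.mem_ofPred_eq, Multiset.range_zero, Multiset.map_zero, add_zero,
    Multiset.mem_map, Finset.mem_val, Finset.mem_Ioc]
  constructor
  · rintro ⟨k, h1, h2, rfl⟩; exact ⟨k, ⟨h1, h2⟩, rfl⟩
  · rintro ⟨k, ⟨h1, h2⟩, rfl⟩; exact ⟨k, h1, h2, rfl⟩

lemma p_zero : p K n 0 = C (n : K) := by simp [p, psum]

lemma e_mem_coneIdeal {j : ℕ} (hj : j ≤ n) : e K n j ∈ coneIdeal K n a j := by
  cases j with
  | zero => exact Submodule.mem_top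
  | succ m =>
    rw [coneIdeal, baseSeq_eq_e_cons hj]
    exact subset_mspan (Multiset.mem_cons_self _ _)

lemma exists_sub_mul_e_mem {j : ℕ} (hj : j ≤ n) {f : R K n} (hf : f ∈ coneIdeal K n a j) :
    ∃ r, f - r * e K n j ∈ coneIdeal K n a (j + 1) := by
  cases j with
  | zero => exact ⟨f, by simp [e_zero]⟩
  | succ m =>
    rw [coneIdeal, baseSeq_eq_e_cons hj] at hf
    obtain ⟨c, hc⟩ := mem_mspan_cons.1 hf
    refine ⟨c, ?_⟩
    rw [coneIdeal, baseSeq_succ_eq_p_cons, mspan_cons, mul_comm c]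
    exact Ideal.mem_sup_right hc

lemma idealJ_ne_top (ha : 2 ≤ a) {j : ℕ} (hj : 1 ≤ j) : idealJ K n a j ≠ ⊤ := by
  refine span_ne_top_of_homPos ?_
  rintro f (⟨i, hi, rfl⟩ | ⟨k, h1, h2, rfl⟩)
  · exact IsHomogeneous.homPos (isHomogeneous_psum _ K _) (by omega)
  · exact IsHomogeneous.homPos (isHomogeneous_es _ K k) (by omega)

lemma idealE_ne_top : idealE K n ≠ ⊤ := by
  refine span_ne_top_of_homPos ?_
  rintro f ⟨k, h1, h2, rfl⟩
  exact IsHomogeneous.homPos (isHomogeneous_es _ K k) (by omega)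

variable [CharZero K]

/-- By Newton's identities, `p_{a+m}` is a scalar multiple of `e_{m+1} p_{a-1}` modulo `coreSeq`. -/
lemma exists_isUnit_p_sub_mem (ha : 1 ≤ a) {m : ℕ} (hm : m < n) :
    ∃ c : R K n, IsUnit c ∧
      p K n (a + m) - c * (e K n (m + 1) * p K n (a - 1)) ∈ mspan (coreSeq K n a m) := by
  set q := Ideal.Quotient.mk (mspan (coreSeq K n a m)) with hq
  have hqe : ∀ i, m + 1 < i → q (e K n i) = 0 := by
    intro i hi
    rcases le_or_gt i n with h | h
    · refine Ideal.Quotient.eq_zero_iff_mem.2 (subset_mspan ?_)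
      exact Multiset.mem_add.2 (Or.inl (Multiset.mem_map_of_mem _ (by simp; omega)))
    · rw [e_eq_zero K n h, map_zero]
  have hqp : ∀ l < m, q (p K n (a + l)) = 0 := by
    intro l hl
    refine Ideal.Quotient.eq_zero_iff_mem.2 (subset_mspan ?_)
    exact Multiset.mem_add.2 (Or.inr (Multiset.mem_map_of_mem
      (fun l => p K n (a + l)) (Multiset.mem_range.2 hl)))
  have hN : ∑ i ∈ Finset.range (a + m), q (e K n i) * q (p K n (a + m - i)) =
      - (a + m : ℕ) * q (e K n (a + m)) := by
    have := congrArg q (sum_es_mul_psum (Fin n) K (a + m))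
    simpa [e_eq, p_eq] using this
  -- Newton's identity in degree `a + m` keeps only `i = 0` and `i = m + 1`: in between the power
  -- sum is in `coreSeq`, and beyond `m + 1` the elementary polynomial vanishes.
  have hterm : ∀ i, i ≠ 0 → i ≠ m + 1 → i < a + m → q (e K n i) * q (p K n (a + m - i)) = 0 := by
    intro i h0 h1 h2
    rcases lt_or_gt_of_ne h1 with h | h
    · rw [show a + m - i = a + (m - i) by omega, hqp _ (by omega), mul_zero]
    · rw [hqe i h, zero_mul]
  -- For `a = 1` the index `m + 1` is the degree itself, so its term sits on the right as `-(m + 1)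
  -- e_{m+1}`; since `p_0 = n`, the scalar is `-(m + 1) / n`. For `a ≥ 2` the right side vanishes
  -- and the scalar is `-1`.
  rcases ha.eq_or_lt with rfl | ha
  · have hn : (n : K) ≠ 0 := by exact_mod_cast (by omega : n ≠ 0)
    have hm1 : ((m : K) + 1) ≠ 0 := by exact_mod_cast Nat.succ_ne_zero m
    refine ⟨C (-(((m : K) + 1) / n)), (isUnit_iff_ne_zero.2 (by
      rw [neg_ne_zero]; exact div_ne_zero hm1 hn)).map (C : K →+* R K n), ?_⟩
    rw [Finset.sum_eq_single_of_mem 0 (by simp) fun i hi h0 =>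
      hterm i h0 (by have := Finset.mem_range.1 hi; omega) (Finset.mem_range.1 hi)] at hN
    rw [e_zero, map_one, one_mul, Nat.sub_zero, add_comm 1 m] at hN
    rw [← Ideal.Quotient.eq_zero_iff_mem, ← hq, add_comm 1 m, map_sub, hN, Nat.sub_self, p_zero]
    have : C (-(((m : K) + 1) / n)) * (e K n (m + 1) * C (n : K)) =
        - (((m + 1 : ℕ) : R K n) * e K n (m + 1)) := by
      have h1 : (((m + 1 : ℕ) : R K n)) = C ((m : K) + 1) := by simp
      rw [h1, ← neg_mul, ← C_neg, mul_left_comm, ← C_mul, mul_comm]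
      congr 2
      field_simp
    rw [this, map_neg, map_mul, map_natCast]
    ring
  · refine ⟨-1, isUnit_one.neg, ?_⟩
    rw [Finset.sum_eq_add_of_mem 0 (m + 1) (by simp; omega) (by simp; omega) (by omega)
      fun i hi h0 => hterm i h0.1 h0.2 (Finset.mem_range.1 hi)] at hN
    rw [hqe (a + m) (by omega), mul_zero, e_zero, map_one, one_mul, Nat.sub_zero,
      show a + m - (m + 1) = a - 1 by omega] at hN
    rw [← Ideal.Quotient.eq_zero_iff_mem, ← hq]
    simpa using hN

/-- Up to a unit, Newton replaces `p_{a+m}` by `e_{m+1} p_{a-1}`, and `e_{m+1}` cancels because it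
is a non-zero-divisor modulo `coreSeq`. -/
lemma mul_e_mem_coneIdeal (ha : 1 ≤ a) {j : ℕ} (hj : j ≤ n) (r : R K n) :
    r * e K n j ∈ coneIdeal K n a (j + 1) ↔ r ∈ idealJ K n a (j + 1) := by
  cases j with
  | zero => rw [e_zero, mul_one, idealJ_one, idealE_eq (a := a)]; rfl
  | succ m =>
    obtain ⟨c, hc, h⟩ := exists_isUnit_p_sub_mem (K := K) ha hj
    have hreg := reg_baseSeq (K := K) ha (show m ≤ n by omega)
    have hpos := homPos_baseSeq (K := K) (n := n) ha (m := m)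
    rw [baseSeq_eq_e_cons hj] at hreg hpos
    have hnzd := (hreg.of_cons hpos).2
    rw [coneIdeal, baseSeq_succ_eq_p_cons, mspan_cons_congr hc h, idealJ_succ_succ ha,
      mem_mspan_cons, mem_mspan_cons]
    refine exists_congr fun d => ?_
    rw [show r * e K n (m + 1) - e K n (m + 1) * p K n (a - 1) * d =
      e K n (m + 1) * (r - p K n (a - 1) * d) by ring]
    exact ⟨hnzd _, Ideal.mul_mem_left _ _⟩

lemma coneIdeal_le_iff (ha : 1 ≤ a) {j : ℕ} (hj : j ≤ n) :
    coneIdeal K n a j ≤ coneIdeal K n a (j + 1) ↔ idealJ K n a (j + 1) = ⊤ := by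
  rw [Ideal.eq_top_iff_one, ← mul_e_mem_coneIdeal ha hj, one_mul]
  refine ⟨fun h => h (e_mem_coneIdeal hj), fun h f hf => ?_⟩
  obtain ⟨r, hr⟩ := exists_sub_mul_e_mem hj hf
  simpa using Ideal.add_mem _ hr (Ideal.mul_mem_left _ r h)

lemma idealJ_one_eq_top {j : ℕ} (h1 : 1 ≤ j) (h2 : j ≤ n) : idealJ K n 1 (j + 1) = ⊤ := by
  have hn : (n : K) ≠ 0 := by exact_mod_cast (by omega : n ≠ 0)
  refine Ideal.eq_top_of_isUnit_mem _ (x := p K n 0) (Ideal.subset_span (Or.inl ⟨0, by omega, rfl⟩)) ?_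
  rw [p_zero]
  exact (isUnit_iff_ne_zero.2 hn).map (C : K →+* R K n)

end Cone

/-! ### Graded isomorphisms and the list of central simple modules -/

section Iso

variable {K : Type*} [Field K] {n a : ℕ}

/-- The map `R → N / N'` that sends `1` to the class of `ε`. -/
def toQuot (N N' : Ideal (A K n a)) (ε : R K n)
    (hε : ∀ r : R K n, Ideal.Quotient.mk (idealI K n a) (rename some (r * ε)) ∈ N) :
    R K n →ₗ[K] ↥N ⧸ Submodule.submoduleOf N' N :=
  (Submodule.mkQ (Submodule.submoduleOf N' N)).restrictScalars K ∘ₗ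
    { toFun := fun r => ⟨Ideal.Quotient.mk (idealI K n a) (rename some (r * ε)), hε r⟩
      map_add' := fun r r' => Subtype.ext (by simp [add_mul])
      map_smul' := fun c r => Subtype.ext (by
        simp only [smul_mul_assoc, map_smul, RingHom.id_apply]
        rfl) }

lemma toQuot_apply {N N' : Ideal (A K n a)} {ε : R K n}
    (hε : ∀ r : R K n, Ideal.Quotient.mk (idealI K n a) (rename some (r * ε)) ∈ N) (r : R K n) :
    toQuot N N' ε hε r = Submodule.Quotient.mk
      ⟨Ideal.Quotient.mk (idealI K n a) (rename some (r * ε)), hε r⟩ := rfl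

lemma mk_submoduleOf_eq_iff {N N' : Ideal (A K n a)} (x y : N) :
    (Submodule.Quotient.mk x : ↥N ⧸ Submodule.submoduleOf N' N) = Submodule.Quotient.mk y ↔
      (x - y : A K n a) ∈ N' := by
  rw [Submodule.Quotient.eq]; rfl

/-- If the ideals `N` and `N'` of `A` are the preimages of the ideals `L` and `L'` of `R` with
`L = L' + (ε)`, then `N / N'` is isomorphic to `R / (L' : ε)`. -/
lemma exists_quot_equiv (N N' : Ideal (A K n a)) (L L' J : Ideal (R K n)) (ε : R K n) (s : ℕ)
    (hN : ∀ f, Ideal.Quotient.mk (idealI K n a) f ∈ N ↔ setZ K n f ∈ L)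
    (hN' : ∀ f, Ideal.Quotient.mk (idealI K n a) f ∈ N' ↔ setZ K n f ∈ L')
    (hε : ε ∈ L) (hLε : ∀ f ∈ L, ∃ r, f - r * ε ∈ L') (hJ : ∀ r, r * ε ∈ L' ↔ r ∈ J)
    (hs : ε.IsHomogeneous s) (hL' : ∀ f ∈ L', ∀ d, homogeneousComponent d f ∈ L') :
    ∃ φ : (R K n ⧸ J) ≃ₗ[K] (↥N ⧸ Submodule.submoduleOf N' N),
      (∀ (f : Rz K n) (m : R K n ⧸ J),
        φ (setZ K n f • m) = Ideal.Quotient.mk (idealI K n a) f • φ m) ∧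
      ∃ s : ℕ, ∀ d : ℕ, (quotComponent K n J d).map φ.toLinearMap =
        (((gradingA K n a (d + s)).comap (N.subtype.restrictScalars K)).map
          ((Submodule.mkQ (Submodule.submoduleOf N' N)).restrictScalars K)) := by
  have hεN : ∀ r : R K n, Ideal.Quotient.mk (idealI K n a) (rename some (r * ε)) ∈ N := fun r => by
    rw [hN, setZ_rename]; exact Ideal.mul_mem_left _ _ hε
  let ψ := toQuot N N' ε hεN
  have hker : LinearMap.ker ψ = J.restrictScalars K := by
    ext r
    rw [LinearMap.mem_ker, Submodule.restrictScalars_mem, ← hJ, toQuot_apply,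
      Submodule.Quotient.mk_eq_zero]
    change Ideal.Quotient.mk (idealI K n a) (rename some (r * ε)) ∈ N' ↔ _
    rw [hN', setZ_rename]
  have hsurj : Function.Surjective ψ := by
    intro x
    obtain ⟨⟨w, hw⟩, rfl⟩ := Submodule.Quotient.mk_surjective _ x
    obtain ⟨f, rfl⟩ := Ideal.Quotient.mk_surjective w
    obtain ⟨r, hr⟩ := hLε _ ((hN f).1 hw)
    refine ⟨r, ?_⟩
    rw [toQuot_apply, mk_submoduleOf_eq_iff, ← map_sub, hN', map_sub, setZ_rename, ← neg_sub]
    exact neg_mem hr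
  let φ : (R K n ⧸ J) ≃ₗ[K] (↥N ⧸ Submodule.submoduleOf N' N) :=
    (Submodule.Quotient.restrictScalarsEquiv K J).symm ≪≫ₗ
      (Submodule.quotEquivOfEq _ _ hker.symm) ≪≫ₗ ψ.quotKerEquivOfSurjective hsurj
  have hφ : ∀ r : R K n, φ (Ideal.Quotient.mk J r) = ψ r := fun r => rfl
  refine ⟨φ, fun f m => ?_, s, fun d => ?_⟩
  · obtain ⟨r, rfl⟩ := Ideal.Quotient.mk_surjective m
    have h1 : setZ K n f • Ideal.Quotient.mk J r = Ideal.Quotient.mk J (setZ K n f * r) := rfl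
    rw [h1, hφ, hφ, toQuot_apply, toQuot_apply, ← Submodule.Quotient.mk_smul,
      mk_submoduleOf_eq_iff]
    change Ideal.Quotient.mk (idealI K n a) (rename some (setZ K n f * r * ε)) -
      Ideal.Quotient.mk (idealI K n a) f *
        Ideal.Quotient.mk (idealI K n a) (rename some (r * ε)) ∈ N'
    rw [← map_mul, ← map_sub, hN', map_sub, setZ_rename, map_mul, setZ_rename, mul_assoc, sub_self]
    exact Ideal.zero_mem _
  · ext x
    constructor
    · rintro ⟨m, ⟨r, hr, rfl⟩, rfl⟩
      refine ⟨⟨Ideal.Quotient.mk (idealI K n a) (rename some (r * ε)), hεN r⟩, ?_, rfl⟩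
      exact ⟨rename some (r * ε), (IsHomogeneous.mul hr hs).rename_isHomogeneous, rfl⟩
    · rintro ⟨⟨w, hw⟩, ⟨f, hf, hfw⟩, rfl⟩
      change Ideal.Quotient.mk (idealI K n a) f = w at hfw
      subst hfw
      obtain ⟨r, hr⟩ := hLε _ ((hN f).1 hw)
      -- The multiplier `r` need not be homogeneous. As `L'` is homogeneous and `f` has degree `d +
      -- s`, the component of `f - r * ε` in that degree shows that the degree `d` part of `r`
      -- suffices.
      refine ⟨Ideal.Quotient.mk J (homogeneousComponent d r),
        ⟨_, homogeneousComponent_isHomogeneous d r, rfl⟩, ?_⟩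
      change φ (Ideal.Quotient.mk J (homogeneousComponent d r)) = Submodule.Quotient.mk _
      rw [hφ, toQuot_apply, mk_submoduleOf_eq_iff, ← map_sub, hN', map_sub, setZ_rename,
        ← neg_sub]
      refine neg_mem ?_
      have h1 := hL' _ hr (d + s)
      rw [map_sub, homogeneousComponent_of_mem (isHomogeneous_setZ K n hf), if_pos rfl] at h1
      convert h1 using 2
      conv_rhs => rw [← sum_homogeneousComponent r, Finset.sum_mul, map_sum]
      have h2 : ∀ i, homogeneousComponent (d + s) (homogeneousComponent i r * ε) =
          if i = d then homogeneousComponent i r * ε else 0 := fun i => by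
        rw [homogeneousComponent_of_mem ((homogeneousComponent_isHomogeneous i r).mul hs)]
        simp [eq_comm]
      simp only [h2]
      rw [Finset.sum_ite_eq']
      split_ifs with h3
      · rfl
      · rw [homogeneousComponent_eq_zero, zero_mul]
        simpa using h3

lemma homogeneousComponent_mem_coneIdeal (ha : 1 ≤ a) (j : ℕ) {f : R K n}
    (hf : f ∈ coneIdeal K n a j) (d : ℕ) : homogeneousComponent d f ∈ coneIdeal K n a j := by
  cases j with
  | zero => exact Submodule.mem_top
  | succ j => exact homogeneousComponent_mem_mspan (homPos_baseSeq ha) hf d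

lemma nontrivial_succQuot_iff {B : Type*} [CommRing B] (y : B) (i : ℕ) :
    Nontrivial (SuccQuot y i) ↔
      ¬ chainIdeal y (nilpotencyClass y - i) ≤ chainIdeal y (nilpotencyClass y - i - 1) := by
  rw [Submodule.Quotient.nontrivial_iff, Ne, Submodule.submoduleOf, Submodule.comap_subtype_eq_top]

lemma chainIdeal_le_of (N N' : Ideal (A K n a)) (L L' : Ideal (R K n))
    (hN : ∀ f, Ideal.Quotient.mk (idealI K n a) f ∈ N ↔ setZ K n f ∈ L)
    (hN' : ∀ f, Ideal.Quotient.mk (idealI K n a) f ∈ N' ↔ setZ K n f ∈ L') :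
    N ≤ N' ↔ L ≤ L' := by
  constructor
  · intro h f hf
    obtain ⟨f, rfl⟩ := setZ_surjective K n f
    exact (hN' f).1 (h ((hN f).2 hf))
  · intro h w hw
    obtain ⟨f, rfl⟩ := Ideal.Quotient.mk_surjective w
    exact (hN' f).2 (h ((hN f).1 hw))

variable [CharZero K]

lemma mk_mem_chainIdeal_left (ha : 1 ≤ a) {j : ℕ} (hj : j ≤ n) (f : Rz K n) :
    Ideal.Quotient.mk (idealI K n a) f ∈
      chainIdeal (zBar K n a) (nilpotencyClass (zBar K n a) - a * j) ↔
      setZ K n f ∈ coneIdeal K n a j := by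
  rw [nilpotencyClass_zBar ha, ← Nat.mul_sub]
  refine mk_mem_chainIdeal_iff ha (by omega) (Nat.mul_lt_mul_of_pos_left (by omega) ha) le_rfl f

lemma mk_mem_chainIdeal_right (ha : 1 ≤ a) {i j : ℕ} (hj : j ≤ n) (h1 : a * j ≤ i)
    (h2 : i < a * (j + 1)) (f : Rz K n) :
    Ideal.Quotient.mk (idealI K n a) f ∈
      chainIdeal (zBar K n a) (nilpotencyClass (zBar K n a) - i - 1) ↔
      setZ K n f ∈ coneIdeal K n a (j + 1) := by
  have e1 : a * (n + 1) = a * j + a * (n + 1 - j) := by rw [← mul_add]; congr 1; omega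
  have e2 : a * (n + 1) = a * (j + 1) + a * (n - j) := by rw [← mul_add]; congr 1; omega
  refine mk_mem_chainIdeal_iff ha (by omega) ?_ ?_ f
  · have e3 : a * (n + 1 - j) = a * (n - j) + a := by
      rw [show n + 1 - j = n - j + 1 by omega, mul_add, mul_one]
    rw [nilpotencyClass_zBar ha, show n + 2 - (j + 1) = n + 1 - j by omega]
    omega
  · rw [nilpotencyClass_zBar ha, show n + 1 - (j + 1) = n - j by omega]
    omega

lemma mem_csmIndices_iff (ha : 1 ≤ a) {i : ℕ} :
    i ∈ csmIndices (zBar K n a) ↔ ∃ j ≤ n, i = a * j ∧ idealJ K n a (j + 1) ≠ ⊤ := by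
  simp only [csmIndices, Finset.mem_filter, Finset.mem_range, nontrivial_succQuot_iff]
  have key : ∀ j ≤ n, ¬ chainIdeal (zBar K n a) (nilpotencyClass (zBar K n a) - a * j) ≤
      chainIdeal (zBar K n a) (nilpotencyClass (zBar K n a) - a * j - 1) ↔
      idealJ K n a (j + 1) ≠ ⊤ := by
    intro j hj
    rw [chainIdeal_le_of _ _ _ _ (mk_mem_chainIdeal_left ha hj)
      (mk_mem_chainIdeal_right ha hj le_rfl (Nat.mul_lt_mul_of_pos_left (Nat.lt_succ_self j) ha)),
      coneIdeal_le_iff ha hj]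
  constructor
  · rintro ⟨h1, h2⟩
    rw [nilpotencyClass_zBar ha] at h1
    have hj : i / a ≤ n := Nat.lt_succ_iff.1 (Nat.div_lt_of_lt_mul h1)
    have hdm := Nat.div_add_mod i a
    have hmod : i % a < a := Nat.mod_lt _ ha
    rcases Nat.eq_zero_or_pos (i % a) with h0 | h0
    · rw [h0, add_zero] at hdm
      refine ⟨i / a, hj, hdm.symm, (key _ hj).1 ?_⟩
      rwa [hdm]
    -- If `a` does not divide `i`, the exponents of numerator and denominator lie in the same block,
    -- so the quotient is zero.
    · refine absurd ?_ h2
      have e1 : nilpotencyClass (zBar K n a) - i = nilpotencyClass (zBar K n a) - (i - 1) - 1 := by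
        rw [nilpotencyClass_zBar ha]; omega
      have e2 : a * (i / a + 1) = a * (i / a) + a := by rw [mul_add, mul_one]
      rw [e1, chainIdeal_le_of _ _ _ _
        (mk_mem_chainIdeal_right (i := i - 1) (j := i / a) ha hj (by omega) (by omega)) (fun f => by
        rw [← e1]
        exact mk_mem_chainIdeal_right (i := i) (j := i / a) ha hj (by omega) (by omega) f)]
  · rintro ⟨j, hj, rfl, h⟩
    refine ⟨?_, (key j hj).2 h⟩
    rw [nilpotencyClass_zBar ha]
    exact Nat.mul_lt_mul_of_pos_left (by omega) ha

/-- The jump at index `a * j` is generated by the class of `e_j`; hence the degrees shift by `j`. -/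
lemma csmIso_of_index_eq (ha : 1 ≤ a) {j : ℕ} (hj : j ≤ n)
    (k : Fin (numCSM (zBar K n a))) (hk : csmIndex (zBar K n a) k = a * j) :
    CSMIso k (idealJ K n a (j + 1)) := by
  refine exists_quot_equiv _ _ (coneIdeal K n a j) (coneIdeal K n a (j + 1)) _ (e K n j) j ?_ ?_
    (e_mem_coneIdeal hj) (fun f hf => exists_sub_mul_e_mem hj hf) (mul_e_mem_coneIdeal ha hj)
    (isHomogeneous_es _ K j) (fun f hf d => homogeneousComponent_mem_coneIdeal ha _ hf d)
  · intro f
    rw [hk]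
    exact mk_mem_chainIdeal_left ha hj f
  · intro f
    rw [hk]
    exact mk_mem_chainIdeal_right ha hj le_rfl
      (Nat.mul_lt_mul_of_pos_left (Nat.lt_succ_self j) ha) f

lemma csmIndices_of_two_le (ha : 2 ≤ a) :
    csmIndices (zBar K n a) = (Finset.range (n + 1)).image (a * ·) := by
  ext i
  rw [mem_csmIndices_iff (by omega), Finset.mem_image]
  constructor
  · rintro ⟨j, hj, rfl, -⟩
    exact ⟨j, Finset.mem_range.2 (by omega), rfl⟩
  · rintro ⟨j, hj, rfl⟩
    have := Finset.mem_range.1 hj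
    exact ⟨j, by omega, rfl, idealJ_ne_top ha (by omega)⟩

lemma csmIndices_one : csmIndices (zBar K n 1) = {0} := by
  ext i
  rw [mem_csmIndices_iff le_rfl, Finset.mem_singleton]
  constructor
  · rintro ⟨j, hj, rfl, h⟩
    rcases Nat.eq_zero_or_pos j with rfl | h0
    · rfl
    · exact absurd (idealJ_one_eq_top h0 hj) h
  · rintro rfl
    exact ⟨0, Nat.zero_le _, rfl, by rw [idealJ_one]; exact idealE_ne_top⟩

lemma numCSM_one : numCSM (zBar K n 1) = 1 := by
  rw [numCSM, csmIndices_one, Finset.card_singleton]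

lemma numCSM_of_two_le (ha : 2 ≤ a) : numCSM (zBar K n a) = n + 1 := by
  rw [numCSM, csmIndices_of_two_le ha, Finset.card_image_of_injective _
    (mul_right_injective₀ (by omega : a ≠ 0)), Finset.card_range]

lemma csmIndex_one (k : Fin (numCSM (zBar K n 1))) : csmIndex (zBar K n 1) k = 0 := by
  have : csmIndex (zBar K n 1) k ∈ csmIndices (zBar K n 1) := Finset.orderEmbOfFin_mem _ rfl k
  rwa [csmIndices_one, Finset.mem_singleton] at this

lemma csmIndex_of_two_le (ha : 2 ≤ a) (k : Fin (numCSM (zBar K n a))) :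
    csmIndex (zBar K n a) k = a * k := by
  have := Finset.orderEmbOfFin_unique (s := csmIndices (zBar K n a)) rfl
    (f := fun k : Fin (numCSM (zBar K n a)) => a * (k : ℕ)) (fun x => ?_) (fun x y hxy => ?_)
  · exact (congrFun this k).symm
  · rw [csmIndices_of_two_le ha]
    refine Finset.mem_image_of_mem _ (Finset.mem_range.2 ?_)
    rw [← numCSM_of_two_le (K := K) ha]
    exact x.2
  · exact Nat.mul_lt_mul_of_pos_left hxy (by omega)

end Iso

/-! ### The Artinian property and the regular sequence of generators -/

section Artinian

variable {K : Type*} [Field K] {n a : ℕ}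

lemma rename_equiv_idealI (f : Equiv.Perm (Option (Fin n))) {g : Rz K n}
    (hg : g ∈ idealI K n a) : rename f g ∈ idealI K n a := by
  have h1 := Ideal.mem_map_of_mem (rename (R := K) f).toRingHom hg
  rw [idealI, Ideal.map_span] at h1
  refine Ideal.span_mono ?_ h1
  rintro _ ⟨g, ⟨k, h1, h2, rfl⟩, rfl⟩
  refine ⟨k, h1, h2, ?_⟩
  rw [pTilde_eq]
  exact rename_psum _ _ k f

variable [CharZero K]

/-- `I` is symmetric in all `n + 1` variables, so the nilpotency of `z̄` carries over by swapping
`z` with the given variable. -/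
lemma isNilpotent_mk_X (ha : 1 ≤ a) (o : Option (Fin n)) :
    IsNilpotent (Ideal.Quotient.mk (idealI K n a) (X o)) := by
  classical
  refine ⟨a * (n + 1), ?_⟩
  have h := rename_equiv_idealI (Equiv.swap none o) (pow_mem_idealI (K := K) (n := n) ha)
  rw [map_pow, zVar, rename_X, Equiv.swap_apply_left] at h
  rw [← map_pow, Ideal.Quotient.eq_zero_iff_mem]
  exact h

/-- A finitely generated algebra whose generators are nilpotent is integral, hence finite, over `K`.
-/
lemma isArtinianRing_A (ha : 1 ≤ a) : IsArtinianRing (A K n a) := by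
  have hint : Algebra.IsIntegral K (A K n a) := by
    refine ⟨fun w => ?_⟩
    obtain ⟨f, rfl⟩ := Ideal.Quotient.mk_surjective w
    induction f using MvPolynomial.induction_on with
    | C c => exact isIntegral_algebraMap (R := K) (A := A K n a) (x := c)
    | add f g hf hg => rw [map_add]; exact hf.add hg
    | mul_X f o hf =>
      rw [map_mul]
      refine hf.mul ?_
      obtain ⟨k, hk⟩ := isNilpotent_mk_X (K := K) ha o
      refine IsIntegral.of_pow (n := k + 1) (Nat.succ_pos k) ?_
      rw [pow_succ, hk, zero_mul]
      exact isIntegral_zero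
  have hfin : Module.Finite K (A K n a) := Algebra.IsIntegral.finite
  exact IsArtinianRing.of_finite K (A K n a)

lemma isRegular_gens (ha : 1 ≤ a) : RingTheory.Sequence.IsRegular (Rz K n) (gens K n a) := by
  have hg : (gens K n a : Multiset (Rz K n)) =
      (Multiset.range (n + 1)).map fun l => pTilde K n (a + l) := by
    rw [gens, List.ofFn_eq_map, ← Multiset.map_coe, Multiset.range, Multiset.map_coe]
    rw [← List.map_coe_finRange_eq_range, Multiset.map_coe, List.map_map]
    rfl
  have hpos : ∀ x ∈ gens K n a, HomPos x := by
    intro x hx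
    obtain ⟨i, rfl⟩ := (List.mem_ofFn' _ _).1 hx
    exact IsHomogeneous.homPos (isHomogeneous_pTilde K n _) (by omega)
  have hreg : Reg (((gens K n a).reverse : List (Rz K n)) : Multiset (Rz K n)) := by
    rw [Multiset.coe_reverse, hg]
    exact reg_psum_option ha fun m hm => reg_baseSeq ha hm
  have hw := (Reg.regL (fun x hx => hpos x (List.mem_reverse.1 hx)) hreg).isWeaklyRegular
  rw [List.reverse_reverse] at hw
  refine ⟨hw, fun h => ?_⟩
  have h1 : (⊤ : Ideal (Rz K n)) = Ideal.ofList (gens K n a) := by simpa using h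
  exact span_ne_top_of_homPos hpos h1.symm

end Artinian

end PowerSumCI

end

theorem theorem3p1 (K : Type*) [Field K] [CharZero K] (n a : ℕ) (ha : 1 ≤ a) :
    -- `A` is an Artinian complete intersection
    (IsArtinianRing (PowerSumCI.A K n a) ∧
      RingTheory.Sequence.IsRegular (PowerSumCI.Rz K n) (PowerSumCI.gens K n a)) ∧
    -- the case `a = 1`
    (a = 1 → ∃ h : PowerSumCI.numCSM (PowerSumCI.zBar K n a) = 1,
      PowerSumCI.CSMIso (Fin.cast h.symm 0) (PowerSumCI.idealE K n)) ∧
    -- the case `a ≥ 2`; `U_{j+1}` for `j = 0, …, n`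
    (2 ≤ a → ∃ h : PowerSumCI.numCSM (PowerSumCI.zBar K n a) = n + 1,
      ∀ j : Fin (n + 1),
        PowerSumCI.CSMIso (Fin.cast h.symm j) (PowerSumCI.idealJ K n a (j + 1))) := by
  refine ⟨⟨PowerSumCI.isArtinianRing_A ha, PowerSumCI.isRegular_gens ha⟩, ?_, fun h => ?_⟩
  · rintro rfl
    refine ⟨PowerSumCI.numCSM_one, ?_⟩
    rw [← PowerSumCI.idealJ_one (a := 1)]
    exact PowerSumCI.csmIso_of_index_eq le_rfl (Nat.zero_le n) _ (PowerSumCI.csmIndex_one _)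
  · exact ⟨PowerSumCI.numCSM_of_two_le h, fun j =>
      PowerSumCI.csmIso_of_index_eq ha (Nat.lt_succ_iff.1 j.2) _ (PowerSumCI.csmIndex_of_two_le h _)⟩
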